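/- Let $\mathbb{T}^2=\mathbb{R}^2/(2\pi\mathbb{Z}^2)$ and, for $f\in L^2(\mathbb{T}^2,\mathbb{R})$ and $n\in\mathbb{Z}^2$, let $\widehat f(n)=(2\pi)^{-2}\int_{\mathbb{T}^2}f(x)e^{-in\cdot x}\,dx$. For $s\ge 0$ let $H^s=H^s(\mathbb{T}^2,\mathbb{R})$ be the space of all $f\in L^2(\mathbb{T}^2,\mathbb{R})$ with $(I-\Delta)^{s/2}f\in L^2(\mathbb{T}^2,\mathbb{R})$, with norm $\|f\|_{H^s}=\|(I-\Delta)^{s/2}f\|_{L^2}$, where $(I-\Delta)^{s/2}f$ has Fourier coefficients $(1+|n|^2)^{s/2}\widehat f(n)$. Let $Q=a_1\partial_1+a_2\partial_2+c$ be a linear differential operator of first order on $\mathbb{T}^2$ with real-valued smooth (hence bounded) coefficients $a_1,a_2,c$; derivatives are taken in the weak sense. (i) There is a constant $C>0$, depending only on $Q$, such that for every $f\in H^2$ the functions $Qf$ and $Q^2f$ are well defined in $L^2(\mathbb{T}^2,\mathbb{R})$ and $$\bigl|\langle Q^2f,f\rangle_{L^2}+\langle Qf,Qf\rangle_{L^2}\bigr|\le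 C\,\|f\|_{L^2}^2 .$$ (ii) Let $k\in[1,\infty)$ be real and let $P$ be a pseudodifferential operator of order $k$ on $\mathbb{T}^2$, that is, $$Pf=\sum_{n\in\mathbb{Z}^2}p(\cdot,n)\,\widehat f(n)\,e^{in\cdot x}\quad\text{(unconditional convergence in }L^2(\mathbb{T}^2,\mathbb{C})),$$ where $p:\mathbb{T}^2\times\mathbb{Z}^2\to\mathbb{C}$ is smooth in $x$ and for all multi-indices $\alpha,\beta$ there is a constant $C_{\alpha\beta}$ with $|\partial_x^\alpha\Delta_n^\beta p(x,n)|\le C_{\alpha\beta}(1+|n|^2)^{(k-|\beta|)/2}$ for all $x,n$; here $\Delta_n^\beta$ is the iterated forward difference in $n$. Then there is a constant $C>0$, depending only on $Q$, $k$ and $P$, such that for every $f\in H^{2+k}$ the functions $Pf$, $PQf$, $PQ^2f$ are well defined in $L^2(\mathbb{T}^2,\mathbb{C})$ and $$\bigl|\langle PQ^2f,Pf\rangle_{L^2}+\langle PQf,PQf\rangle_{L^2}\bigr|\le C\,\|f\|_{H^k}^2 ,$$ where $\langle u,v\rangle_{L^2}=\operatorname{Re}\int_{\mathbb{T}^2}u\,\overline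 v\,dx$ (the usual real pairing when $P$ maps real functions to real functions). -/

import Mathlib

open MeasureTheory
open scoped Real ContDiff ENNReal

namespace TorusPDO

/-- Positivity of the period `2π`, needed for the measure on the circle. -/
instance factTwoPiPos : Fact (0 < 2 * π) := ⟨Real.two_pi_pos⟩

/-- The two-dimensional square torus `𝕋² = ℝ² / (2πℤ²)`; its `volume` is Lebesgue measure,
of total mass `(2π)²`. -/
abbrev Torus : Type := Fin 2 → AddCircle (2 * π)

/-- The frequency lattice `ℤ²`. -/
abbrev Freq : Type := Fin 2 → ℤ

/-- The space `L²(𝕋², ℝ)`. -/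
abbrev L2R : Type := Lp ℝ 2 (volume : Measure Torus)

/-- The space `L²(𝕋², ℂ)`. -/
abbrev L2C : Type := Lp ℂ 2 (volume : Measure Torus)

/-- The `2π`-periodic function on `ℝ²` that corresponds to a function on the torus. -/
noncomputable def lift {E : Type*} (a : Torus → E) : (Fin 2 → ℝ) → E :=
  fun y => a (fun i => (y i : AddCircle (2 * π)))

/-- A function on the torus is smooth if its periodic lift to `ℝ²` is `C^∞`. -/
def IsSmooth {E : Type*} [NormedAddCommGroup E] [NormedSpace ℝ E] (a : Torus → E) : Prop :=
  ContDiff ℝ ∞ (lift a)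

/-- The exponential `e_n(x) = exp(i n·x)`, for `n ∈ ℤ²`. -/
noncomputable def expMode (n : Freq) : C(Torus, ℂ) where
  toFun x := ∏ i, fourier (n i) (x i)
  continuous_toFun := by fun_prop

/-- Fourier coefficients `f̂(n) = (2π)⁻² ∫ f(x) exp(-i n·x) dx`. -/
noncomputable def coeff (f : L2R) (n : Freq) : ℂ :=
  ((2 * π : ℝ) ^ 2 : ℂ)⁻¹ * ∫ x, (f x : ℂ) * expMode (-n) x

/-- `1 + |n|²`, with the Euclidean length of `n`. -/
def bracketSq (n : Freq) : ℝ := 1 + ((n 0 : ℝ) ^ 2 + (n 1 : ℝ) ^ 2)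

/-- `g = (I - Δ)^{s/2} f`: the Fourier transform of `g` is `(1 + |n|²)^{s/2} f̂(n)`. -/
def IsBesselPotential (s : ℝ) (f g : L2R) : Prop :=
  ∀ n, coeff g n = ((bracketSq n ^ (s / 2) : ℝ) : ℂ) * coeff f n

/-- `f ∈ H^s(𝕋², ℝ)`, that is, `f ∈ L²` and `(I - Δ)^{s/2} f ∈ L²` (for `s ≥ 0`). -/
def MemSobolev (s : ℝ) (f : L2R) : Prop :=
  ∃ g : L2R, IsBesselPotential s f g

/-- The norm `‖f‖_{H^s} = ‖(I - Δ)^{s/2} f‖_{L²}` of `f ∈ H^s`. The set below has exactly one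
element then, because an `L²` function is determined by its Fourier coefficients. -/
noncomputable def sobolevNorm (s : ℝ) (f : L2R) : ℝ :=
  sInf {r : ℝ | ∃ g : L2R, IsBesselPotential s f g ∧ r = ‖g‖}

/-- `g ∈ L²` is the (weak, equivalently distributional) partial derivative `∂_j f`:
the Fourier transform of `g` is `i n_j f̂(n)`. -/
def IsWeakPartial (j : Fin 2) (f g : L2R) : Prop :=
  ∀ n, coeff g n = Complex.I * (n j : ℂ) * coeff f n

/-- A linear differential operator of first order `a₁ ∂₁ + a₂ ∂₂ + c` on the torus, whose
coefficients are real and smooth (and hence bounded with all derivatives, by compactness). -/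
structure FirstOrderOperator where
  /-- the coefficients of the derivatives -/
  a : Fin 2 → Torus → ℝ
  /-- the coefficient of the term of order zero -/
  c : Torus → ℝ
  smooth_a : ∀ j, IsSmooth (a j)
  smooth_c : IsSmooth c

/-- `u = Q f`: the weak derivatives `∂₁ f`, `∂₂ f` exist in `L²`, and
`u = a₁ ∂₁ f + a₂ ∂₂ f + c f` almost everywhere. -/
def FirstOrderOperator.Maps (Q : FirstOrderOperator) (f u : L2R) : Prop :=
  ∃ D : Fin 2 → L2R, (∀ j, IsWeakPartial j f (D j)) ∧
    ∀ᵐ x : Torus, u x = ∑ j, Q.a j x * D j x + Q.c x * f x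

/-- The difference operator `Δ^β = Δ₁^{β₁} Δ₂^{β₂}` in the frequency variable, where
`(Δ_j p)(n) = p(n + e_j) - p(n)`. -/
noncomputable def freqDiff (β : Fin 2 → ℕ) (p : Freq → C(Torus, ℂ)) : Freq → C(Torus, ℂ) :=
  (fwdDiff (Pi.single 0 1 : Freq))^[β 0] ((fwdDiff (Pi.single 1 1 : Freq))^[β 1] p)

/-- A pseudodifferential operator of order `k` on the torus, given by its symbol
`p(x, n)`, `x ∈ 𝕋²`, `n ∈ ℤ²`, in the class `S^k = S^k_{1,0}(𝕋² × ℤ²)`: smooth in `x`, with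
`|∂_x^α Δ_n^β p(x, n)| ≤ C_{α,β} (1 + |n|²)^{(k - |β|)/2}` for all orders `α`, `β`. -/
structure PseudoDiffOperator (k : ℝ) where
  /-- the symbol, `symbol n x = p(x, n)` -/
  symbol : Freq → C(Torus, ℂ)
  smooth : ∀ n, IsSmooth (symbol n)
  bound : ∀ (α : ℕ) (β : Fin 2 → ℕ), ∃ C : ℝ, ∀ (n : Freq) (y : Fin 2 → ℝ),
    ‖iteratedFDeriv ℝ α (lift (freqDiff β symbol n)) y‖
      ≤ C * bracketSq n ^ ((k - ((β 0 + β 1 : ℕ) : ℝ)) / 2)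

/-- `u = P f`, where `P f = ∑_n p(·, n) f̂(n) e_n`, with (unconditional) convergence in `L²`. -/
def PseudoDiffOperator.Maps {k : ℝ} (P : PseudoDiffOperator k) (f : L2R) (u : L2C) : Prop :=
  HasSum (fun n : Freq =>
    coeff f n • ContinuousMap.toLp (E := ℂ) 2 (volume : Measure Torus) ℂ
      (P.symbol n * expMode n)) u

end TorusPDO

/-! Let T = P*P, an operator of order 2k, and let y = Qf. The quantity to be bounded is the real
part of ⟨TQy, f⟩ + ⟨Ty, Qf⟩ = ⟨Sy, f⟩ with S = TQ + Q*T. The coefficients of Q are real, so Q + Q*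
has order zero, and S = [T, Q] + (Q + Q*)T has order 2k again instead of 2k + 1. Since S is
self-adjoint, 2 Re⟨SQf, f⟩ = ⟨(SQ + Q*S)f, f⟩, and by the same argument SQ + Q*S has order 2k. Its
quadratic form is therefore controlled by the square of the H^k norm. The first claim is the case P
= I.

The argument runs on Fourier coefficients, where operators are matrices indexed by frequencies.
Pseudodifferential operators become matrices that decay rapidly off the diagonal and whose
differences along the diagonal lower the order (`SymbolClass`); these classes are stable under
adjoints and products. A commutator with a multiplication operator gains one order
(`SymbolClass.commToep`), which gives the stability of the order under T ↦ TQ + Q*T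
(`FirstOrderData.symbolClass_symm`). Each use of this map spends one difference, so two differences
of P suffice in `exists_energy_bound`.

The passage from functions to sequences needs Parseval's identity and a quantitative decay estimate
for the coefficients of smooth functions (`norm_fourierC_mul_bracketSq_pow_le`), applied uniformly
to the symbol of P. -/

namespace TorusPDO

/-! ### The weight 1 + |n|² on the lattice. -/

lemma one_le_bracketSq (n : Freq) : 1 ≤ bracketSq n := by
  unfold bracketSq; nlinarith [sq_nonneg (n 0 : ℝ), sq_nonneg (n 1 : ℝ)]

lemma bracketSq_pos (n : Freq) : 0 < bracketSq n := zero_lt_one.trans_le (one_le_bracketSq n)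

lemma bracketSq_neg (n : Freq) : bracketSq (-n) = bracketSq n := by
  simp [bracketSq]

lemma bracketSq_sub_comm (m n : Freq) : bracketSq (m - n) = bracketSq (n - m) := by
  rw [← bracketSq_neg, neg_sub]

lemma bracketSq_zero : bracketSq 0 = 1 := by simp [bracketSq]

lemma bracketSq_add_le (m n : Freq) : bracketSq (m + n) ≤ 2 * bracketSq m * bracketSq n := by
  have key : ∀ a b c d : ℝ, 1 + ((a + c) ^ 2 + (b + d) ^ 2)
      ≤ 2 * (1 + (a ^ 2 + b ^ 2)) * (1 + (c ^ 2 + d ^ 2)) := by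
    intro a b c d
    nlinarith [sq_nonneg (a - c), sq_nonneg (b - d), sq_nonneg (a * c), sq_nonneg (a * d),
      sq_nonneg (b * c), sq_nonneg (b * d)]
  simpa [bracketSq] using key (m 0) (m 1) (n 0) (n 1)

lemma bracketSq_rpow_pos (n : Freq) (s : ℝ) : 0 < bracketSq n ^ s :=
  Real.rpow_pos_of_pos (bracketSq_pos n) s

/-- Peetre's inequality, with a natural exponent for the difference. -/
lemma exists_bracketSq_rpow_le (s : ℝ) :
    ∃ M : ℕ, ∀ m n : Freq,
      bracketSq m ^ s ≤ 2 ^ M * bracketSq (m - n) ^ M * bracketSq n ^ s := by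
  obtain ⟨M, hM⟩ := exists_nat_ge |s|
  refine ⟨M, fun m n => ?_⟩
  have h1 : (2 * bracketSq (m - n)) ^ |s| ≤ 2 ^ M * bracketSq (m - n) ^ M := by
    rw [← mul_pow, ← Real.rpow_natCast]
    exact Real.rpow_le_rpow_of_exponent_le (by linarith [one_le_bracketSq (m - n)]) hM
  refine le_trans ?_ (mul_le_mul_of_nonneg_right h1 (bracketSq_rpow_pos n s).le)
  have hp := bracketSq_pos (m - n)
  rcases le_total 0 s with hs | hs
  · rw [abs_of_nonneg hs, ← Real.mul_rpow (by positivity) (bracketSq_pos n).le]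
    refine Real.rpow_le_rpow (bracketSq_pos m).le ?_ hs
    simpa using bracketSq_add_le (m - n) n
  · have h2 : bracketSq n ≤ 2 * bracketSq (m - n) * bracketSq m := by
      rw [bracketSq_sub_comm]; simpa using bracketSq_add_le (n - m) m
    have h3 := Real.rpow_le_rpow_of_nonpos (bracketSq_pos n) h2 hs
    rw [Real.mul_rpow (by positivity) (bracketSq_pos m).le] at h3
    calc bracketSq m ^ s = (2 * bracketSq (m - n)) ^ |s| *
          ((2 * bracketSq (m - n)) ^ s * bracketSq m ^ s) := by
          rw [← mul_assoc, ← Real.rpow_add (by positivity), abs_of_nonpos hs]; simp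
      _ ≤ _ := mul_le_mul_of_nonneg_left h3 (by positivity)

lemma abs_coord_le_bracketSq_rpow (n : Freq) (j : Fin 2) :
    |(n j : ℝ)| ≤ bracketSq n ^ (1 / 2 : ℝ) := by
  rw [← Real.sqrt_eq_rpow]
  refine Real.abs_le_sqrt ?_
  unfold bracketSq
  fin_cases j <;> simp <;> nlinarith [sq_nonneg (n 0 : ℝ), sq_nonneg (n 1 : ℝ)]

lemma abs_coord_le_bracketSq (n : Freq) (j : Fin 2) : |(n j : ℝ)| ≤ bracketSq n := by
  refine (abs_coord_le_bracketSq_rpow n j).trans ?_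
  simpa using Real.rpow_le_rpow_of_exponent_le (one_le_bracketSq n)
    (show (1 / 2 : ℝ) ≤ 1 by norm_num)

/-- A summable weight on the frequency lattice. -/
noncomputable def sumWeight (h : Freq) : ℝ := (bracketSq h ^ 2)⁻¹

lemma sumWeight_pos (h : Freq) : 0 < sumWeight h := by
  have := bracketSq_pos h
  unfold sumWeight; positivity

lemma sumWeight_mul (h : Freq) : sumWeight h * bracketSq h ^ 2 = 1 := by
  have := bracketSq_pos h
  unfold sumWeight; field_simp

/-- Since (1 + a²)(1 + b²) ≤ (1 + a² + b²)², a product of two convergent one-dimensional series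
dominates. -/
lemma summable_sumWeight : Summable sumWeight := by
  have h1 : Summable fun a : ℤ => (1 + (a : ℝ) ^ 2)⁻¹ := by
    have h0 : Summable fun a : ℤ => 1 / (a : ℝ) ^ 2 :=
      Real.summable_one_div_int_pow.mpr (by norm_num)
    refine Summable.of_norm_bounded_eventually h0 ?_
    refine (Set.finite_singleton (0 : ℤ)).subset fun a ha => ?_
    by_contra h
    refine ha ?_
    have : (0 : ℝ) < (a : ℝ) ^ 2 := by
      have : (a : ℝ) ≠ 0 := by exact_mod_cast h
      positivity
    rw [Set.mem_ofPred_eq, Real.norm_of_nonneg (by positivity), one_div]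
    exact inv_anti₀ this (by linarith)
  have h2 := h1.mul_of_nonneg h1 (fun _ => by positivity) (fun _ => by positivity)
  rw [← (piFinTwoEquiv fun _ => ℤ).summable_iff] at h2
  refine Summable.of_nonneg_of_le (fun h => (sumWeight_pos h).le) (fun h => ?_) h2
  simp only [Function.comp, piFinTwoEquiv_apply, sumWeight, ← mul_inv]
  refine inv_anti₀ (by positivity) ?_
  unfold bracketSq
  nlinarith [sq_nonneg (h 0 : ℝ), sq_nonneg (h 1 : ℝ), sq_nonneg ((h 0 : ℝ)^2),
    sq_nonneg ((h 1 : ℝ)^2), mul_nonneg (sq_nonneg (h 0 : ℝ)) (sq_nonneg (h 1 : ℝ))]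

lemma summable_sumWeight_sub_left (l : Freq) : Summable fun n => sumWeight (l - n) :=
  ((Equiv.subLeft l).summable_iff (f := sumWeight)).mpr summable_sumWeight

lemma summable_sumWeight_sub_right (n : Freq) : Summable fun m => sumWeight (m - n) :=
  ((Equiv.subRight n).summable_iff (f := sumWeight)).mpr summable_sumWeight

lemma tsum_sumWeight_sub_left (l : Freq) : ∑' n, sumWeight (l - n) = ∑' h, sumWeight h :=
  (Equiv.subLeft l).tsum_eq sumWeight

lemma tsum_sumWeight_sub_right (n : Freq) : ∑' m, sumWeight (m - n) = ∑' h, sumWeight h :=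
  (Equiv.subRight n).tsum_eq sumWeight

/-! ### Matrices with rapid off-diagonal decay. -/

/-- Infinite matrices indexed by frequencies: operators on the torus on the Fourier side. -/
abbrev Kernel : Type := Freq → Freq → ℂ

/-- Kernels of order `2σ`: rapid decay off the diagonal, growth of order `2σ` along it. -/
def Decay (σ : ℝ) (K : Kernel) : Prop :=
  ∀ N : ℕ, ∃ C : ℝ, ∀ l n, ‖K l n‖ * bracketSq (l - n) ^ N ≤ C * bracketSq n ^ σ

/-- Rapidly decreasing sequences. -/
def RapidDecay (α : Freq → ℂ) : Prop :=
  ∀ N : ℕ, ∃ C : ℝ, ∀ m, ‖α m‖ * bracketSq m ^ N ≤ C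

lemma Decay.exists_nonneg {σ : ℝ} {K : Kernel} (hK : Decay σ K) (N : ℕ) :
    ∃ C : ℝ, 0 ≤ C ∧ ∀ l n, ‖K l n‖ * bracketSq (l - n) ^ N ≤ C * bracketSq n ^ σ := by
  obtain ⟨C, hC⟩ := hK N
  refine ⟨C, ?_, hC⟩
  have := hC 0 0
  simp only [sub_self, bracketSq_zero, one_pow, Real.one_rpow, mul_one] at this
  exact (norm_nonneg _).trans this

lemma Decay.mono {σ τ : ℝ} (h : σ ≤ τ) {K : Kernel} (hK : Decay σ K) : Decay τ K := by
  intro N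
  obtain ⟨C, hC0, hC⟩ := hK.exists_nonneg N
  exact ⟨C, fun l n => (hC l n).trans (mul_le_mul_of_nonneg_left
    (Real.rpow_le_rpow_of_exponent_le (one_le_bracketSq n) h) hC0)⟩

lemma Decay.add {σ : ℝ} {A B : Kernel} (hA : Decay σ A) (hB : Decay σ B) :
    Decay σ (A + B) := by
  intro N
  obtain ⟨C, hC⟩ := hA N
  obtain ⟨D, hD⟩ := hB N
  refine ⟨C + D, fun l n => ?_⟩
  have hp : 0 ≤ bracketSq (l - n) ^ N := pow_nonneg (bracketSq_pos _).le N
  calc ‖(A + B) l n‖ * bracketSq (l - n) ^ N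
      ≤ (‖A l n‖ + ‖B l n‖) * bracketSq (l - n) ^ N :=
        mul_le_mul_of_nonneg_right (norm_add_le _ _) hp
    _ ≤ _ := by linarith [hC l n, hD l n]

lemma Decay.smul {σ : ℝ} {A : Kernel} (c : ℂ) (hA : Decay σ A) : Decay σ (c • A) := by
  intro N
  obtain ⟨C, hC⟩ := hA N
  refine ⟨‖c‖ * C, fun l n => ?_⟩
  simp only [Pi.smul_apply, norm_smul, mul_assoc]
  exact mul_le_mul_of_nonneg_left (hC l n) (norm_nonneg c)

/-- The adjoint kernel. -/
noncomputable def adj (K : Kernel) : Kernel := fun l n => starRingEnd ℂ (K n l)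

/-- Peetre's inequality moves the growth weight from one index to the other; the price is `M` powers
of the off-diagonal weight, which rapid decay supplies. -/
lemma Decay.adj {σ : ℝ} {K : Kernel} (hK : Decay σ K) : Decay σ (adj K) := by
  intro N
  obtain ⟨M, hM⟩ := exists_bracketSq_rpow_le σ
  obtain ⟨C, hC0, hC⟩ := hK.exists_nonneg (N + M)
  refine ⟨C * 2 ^ M, fun l n => ?_⟩
  have hp : 0 < bracketSq (l - n) ^ M := pow_pos (bracketSq_pos _) M
  have h1 := hC n l
  have h2 := mul_le_mul_of_nonneg_left (hM l n) hC0
  rw [bracketSq_sub_comm n l, pow_add] at h1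
  simp only [TorusPDO.adj, RCLike.norm_conj]
  refine le_of_mul_le_mul_right ?_ hp
  linarith

/-- Translation of a kernel along the diagonal by a unit vector. -/
def shift (i : Fin 2) (K : Kernel) : Kernel :=
  fun l n => K (l + Pi.single i 1) (n + Pi.single i 1)

/-- Composition of kernels. -/
noncomputable def comp (A B : Kernel) : Kernel := fun l n => ∑' m, A l m * B m n

/-- The off-diagonal weight is submultiplicative along l, m, n, and Peetre's inequality replaces the
growth in m by growth in n. The decay of `B` pays for `N` powers from the splitting, `M` from
Peetre, and two more to leave a weight summable in m. -/
lemma exists_comp_term_bound {σ τ : ℝ} {A B : Kernel} (hA : Decay σ A) (hB : Decay τ B)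
    (N : ℕ) : ∃ C : ℝ, 0 ≤ C ∧ ∀ l m n, ‖A l m‖ * ‖B m n‖ * bracketSq (l - n) ^ N
      ≤ C * sumWeight (m - n) * bracketSq n ^ (σ + τ) := by
  obtain ⟨M, hM⟩ := exists_bracketSq_rpow_le σ
  obtain ⟨C, hC0, hC⟩ := hA.exists_nonneg N
  obtain ⟨D, hD0, hD⟩ := hB.exists_nonneg (N + M + 2)
  refine ⟨2 ^ N * 2 ^ M * C * D, by positivity, fun l m n => ?_⟩
  have hx := bracketSq_pos (m - n)
  have hw : bracketSq (l - n) ^ N ≤ 2 ^ N * bracketSq (l - m) ^ N * bracketSq (m - n) ^ N := by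
    rw [← mul_pow, ← mul_pow]
    refine pow_le_pow_left₀ (bracketSq_pos _).le ?_ N
    simpa using bracketSq_add_le (l - m) (m - n)
  have hA' : ‖A l m‖ * bracketSq (l - m) ^ N
      ≤ C * (2 ^ M * bracketSq (m - n) ^ M * bracketSq n ^ σ) :=
    (hC l m).trans (mul_le_mul_of_nonneg_left (hM m n) hC0)
  have hs := bracketSq_rpow_pos n σ
  have hq := sumWeight_mul (m - n)
  have hq0 := sumWeight_pos (m - n)
  calc ‖A l m‖ * ‖B m n‖ * bracketSq (l - n) ^ N
      ≤ ‖A l m‖ * ‖B m n‖ * (2 ^ N * bracketSq (l - m) ^ N * bracketSq (m - n) ^ N) :=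
        mul_le_mul_of_nonneg_left hw (by positivity)
    _ = 2 ^ N * (‖A l m‖ * bracketSq (l - m) ^ N) * (‖B m n‖ * bracketSq (m - n) ^ N) := by ring
    _ ≤ 2 ^ N * (C * (2 ^ M * bracketSq (m - n) ^ M * bracketSq n ^ σ)) *
          (‖B m n‖ * bracketSq (m - n) ^ N) := by gcongr
    _ = 2 ^ N * 2 ^ M * C * bracketSq n ^ σ * sumWeight (m - n) *
          (‖B m n‖ * bracketSq (m - n) ^ (N + M + 2)) := by
        linear_combination (-(2 ^ N * (C * (2 ^ M * bracketSq (m - n) ^ M * bracketSq n ^ σ)) *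
          (‖B m n‖ * bracketSq (m - n) ^ N))) * hq
    _ ≤ 2 ^ N * 2 ^ M * C * bracketSq n ^ σ * sumWeight (m - n) * (D * bracketSq n ^ τ) := by
        exact mul_le_mul_of_nonneg_left (hD m n) (by positivity)
    _ = _ := by rw [Real.rpow_add (bracketSq_pos n)]; ring

lemma summable_comp_norm {σ τ : ℝ} {A B : Kernel} (hA : Decay σ A) (hB : Decay τ B)
    (l n : Freq) : Summable fun m => ‖A l m‖ * ‖B m n‖ := by
  obtain ⟨C, -, hC⟩ := exists_comp_term_bound hA hB 0
  refine Summable.of_nonneg_of_le (fun m => by positivity) (fun m => ?_)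
    (((summable_sumWeight_sub_right n).mul_left C).mul_right (bracketSq n ^ (σ + τ)))
  simpa using hC l m n

lemma summable_comp {σ τ : ℝ} {A B : Kernel} (hA : Decay σ A) (hB : Decay τ B)
    (l n : Freq) : Summable fun m => A l m * B m n :=
  .of_norm (by simpa using summable_comp_norm hA hB l n)

lemma Decay.comp {σ τ : ℝ} {A B : Kernel} (hA : Decay σ A) (hB : Decay τ B) :
    Decay (σ + τ) (comp A B) := by
  intro N
  obtain ⟨C, hC0, hC⟩ := exists_comp_term_bound hA hB N
  refine ⟨C * ∑' h, sumWeight h, fun l n => ?_⟩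
  have hs := (summable_comp_norm hA hB l n)
  calc ‖TorusPDO.comp A B l n‖ * bracketSq (l - n) ^ N
      ≤ (∑' m, ‖A l m‖ * ‖B m n‖) * bracketSq (l - n) ^ N := by
        refine mul_le_mul_of_nonneg_right ?_ (pow_nonneg (bracketSq_pos _).le N)
        refine (norm_tsum_le_tsum_norm (by simpa using hs)).trans (by simp)
    _ = ∑' m, ‖A l m‖ * ‖B m n‖ * bracketSq (l - n) ^ N := tsum_mul_right.symm
    _ ≤ ∑' m, C * sumWeight (m - n) * bracketSq n ^ (σ + τ) :=
        (hs.mul_right _).tsum_le_tsum (fun m => hC l m n)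
          (((summable_sumWeight_sub_right n).mul_left C).mul_right _)
    _ = _ := by rw [tsum_mul_right, tsum_mul_left, tsum_sumWeight_sub_right]

lemma comp_sub_left {σ τ : ℝ} {A A' B : Kernel} (hA : Decay σ A) (hA' : Decay σ A')
    (hB : Decay τ B) : comp (A - A') B = comp A B - comp A' B := by
  ext l n
  simp only [comp, Pi.sub_apply, sub_mul]
  exact (summable_comp hA hB l n).tsum_sub (summable_comp hA' hB l n)

lemma comp_sub_right {σ τ : ℝ} {A B B' : Kernel} (hA : Decay σ A) (hB : Decay τ B)
    (hB' : Decay τ B') : comp A (B - B') = comp A B - comp A B' := by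
  ext l n
  simp only [comp, Pi.sub_apply, mul_sub]
  exact (summable_comp hA hB l n).tsum_sub (summable_comp hA hB' l n)

/-- A shift is conjugation by multiplication with an exponential, hence multiplicative. -/
lemma shift_comp (i : Fin 2) (A B : Kernel) :
    shift i (comp A B) = comp (shift i A) (shift i B) := by
  ext l n
  simp only [shift, comp]
  exact ((Equiv.addRight (Pi.single i (1 : ℤ) : Freq)).tsum_eq
    (fun m => A (l + Pi.single i 1) m * B m (n + Pi.single i 1))).symm

lemma shift_sub (i : Fin 2) (A B : Kernel) : shift i (A - B) = shift i A - shift i B := rfl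

lemma shift_add (i : Fin 2) (A B : Kernel) : shift i (A + B) = shift i A + shift i B := rfl

lemma shift_smul (i : Fin 2) (c : ℂ) (A : Kernel) : shift i (c • A) = c • shift i A := rfl

lemma shift_adj (i : Fin 2) (A : Kernel) : shift i (adj A) = adj (shift i A) := rfl

lemma adj_sub (A B : Kernel) : adj (A - B) = adj A - adj B := by
  ext l n; simp [adj]

lemma adj_adj (A : Kernel) : adj (adj A) = A := by
  ext l n; simp [adj]

lemma adj_add (A B : Kernel) : adj (A + B) = adj A + adj B := by
  ext l n; simp [adj]

lemma adj_comp (A B : Kernel) : adj (comp A B) = comp (adj B) (adj A) := by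
  ext l n
  simp only [adj, comp, Complex.conj_tsum, map_mul]
  exact tsum_congr fun m => mul_comm _ _

/-- The multiplication operator with Fourier coefficients `α`. -/
def toep (α : Freq → ℂ) : Kernel := fun l n => α (l - n)

lemma shift_toep (i : Fin 2) (α : Freq → ℂ) : shift i (toep α) = toep α := by
  ext l n; simp [shift, toep]

lemma RapidDecay.decay_toep {α : Freq → ℂ} (hα : RapidDecay α) : Decay 0 (toep α) := by
  intro N
  obtain ⟨C, hC⟩ := hα N
  exact ⟨C, fun l n => by simpa [toep] using hC (l - n)⟩

/-! ### Symbol classes and their algebra. -/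

/-- Kernels of order `2σ` whose first `j` differences along the diagonal each lower the
order by one. -/
def SymbolClass : ℕ → ℝ → Kernel → Prop
  | 0, σ, K => Decay σ K
  | j + 1, σ, K => Decay σ K ∧ ∀ i, SymbolClass j (σ - 1 / 2) (shift i K - K)

lemma SymbolClass.decay {j : ℕ} {σ : ℝ} {K : Kernel} (h : SymbolClass j σ K) : Decay σ K := by
  cases j with
  | zero => exact h
  | succ j => exact h.1

lemma SymbolClass.mono_order {j : ℕ} {σ τ : ℝ} (hst : σ ≤ τ) {K : Kernel}
    (h : SymbolClass j σ K) : SymbolClass j τ K := by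
  induction j generalizing σ τ K with
  | zero => exact Decay.mono hst h
  | succ j ih => exact ⟨h.1.mono hst, fun i => ih (by linarith) (h.2 i)⟩

lemma SymbolClass.of_succ {j : ℕ} {σ : ℝ} {K : Kernel} (h : SymbolClass (j + 1) σ K) :
    SymbolClass j σ K := by
  induction j generalizing σ K with
  | zero => exact h.1
  | succ j ih => exact ⟨h.1, fun i => ih (h.2 i)⟩

lemma SymbolClass.add {j : ℕ} {σ : ℝ} {A B : Kernel} (hA : SymbolClass j σ A)
    (hB : SymbolClass j σ B) : SymbolClass j σ (A + B) := by
  induction j generalizing σ A B with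
  | zero => exact Decay.add hA hB
  | succ j ih =>
    refine ⟨hA.1.add hB.1, fun i => ?_⟩
    rw [shift_add, add_sub_add_comm]
    exact ih (hA.2 i) (hB.2 i)

lemma SymbolClass.smul {j : ℕ} {σ : ℝ} {A : Kernel} (c : ℂ) (hA : SymbolClass j σ A) :
    SymbolClass j σ (c • A) := by
  induction j generalizing σ A with
  | zero => exact Decay.smul c hA
  | succ j ih =>
    refine ⟨hA.1.smul c, fun i => ?_⟩
    rw [shift_smul, ← smul_sub]
    exact ih (hA.2 i)

lemma SymbolClass.adj {j : ℕ} {σ : ℝ} {A : Kernel} (hA : SymbolClass j σ A) :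
    SymbolClass j σ (adj A) := by
  induction j generalizing σ A with
  | zero => exact Decay.adj hA
  | succ j ih =>
    refine ⟨hA.1.adj, fun i => ?_⟩
    rw [shift_adj, ← adj_sub]
    exact ih (hA.2 i)

lemma SymbolClass.shift {j : ℕ} {σ : ℝ} {A : Kernel} (i : Fin 2)
    (hA : SymbolClass (j + 1) σ A) : SymbolClass j σ (shift i A) := by
  have := ((hA.2 i).mono_order (show σ - 1 / 2 ≤ σ by linarith)).add hA.of_succ
  rwa [sub_add_cancel] at this

/-- Induction on `j` through the discrete Leibniz rule, in which one of the two terms carries a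
shifted factor. -/
lemma SymbolClass.comp {j : ℕ} {σ τ : ℝ} {A B : Kernel} (hA : SymbolClass j σ A)
    (hB : SymbolClass j τ B) : SymbolClass j (σ + τ) (comp A B) := by
  induction j generalizing σ τ A B with
  | zero => exact Decay.comp hA hB
  | succ j ih =>
    refine ⟨hA.1.comp hB.1, fun i => ?_⟩
    have hsA := hA.shift i
    have hsB := hB.shift i
    have key : TorusPDO.shift i (TorusPDO.comp A B) - TorusPDO.comp A B =
        TorusPDO.comp (TorusPDO.shift i A) (TorusPDO.shift i B - B) +
          TorusPDO.comp (TorusPDO.shift i A - A) B := by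
      rw [shift_comp, comp_sub_right hsA.decay hsB.decay hB.1, comp_sub_left hsA.decay hA.1 hB.1]
      abel
    rw [key]
    refine SymbolClass.add ?_ ?_
    · exact (ih hsA (hB.2 i)).mono_order (by linarith)
    · exact (ih (hA.2 i) hB.of_succ).mono_order (by linarith)

lemma decay_zero (σ : ℝ) : Decay σ 0 := fun N => ⟨0, fun l n => by simp⟩

lemma symbolClass_zero (j : ℕ) (σ : ℝ) : SymbolClass j σ 0 := by
  induction j generalizing σ with
  | zero => exact decay_zero σ
  | succ j ih => exact ⟨decay_zero σ, fun i => by simpa using! ih (σ - 1 / 2)⟩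

lemma RapidDecay.symbolClass_toep {α : Freq → ℂ} (hα : RapidDecay α) (j : ℕ) :
    SymbolClass j 0 (toep α) := by
  cases j with
  | zero => exact hα.decay_toep
  | succ j => exact ⟨hα.decay_toep, fun i => by
      rw [shift_toep, sub_self]; exact symbolClass_zero j _⟩

/-- Composition with the partial derivative in direction `i` on the right, up to `I`. -/
def mulFreq (i : Fin 2) (A : Kernel) : Kernel := fun l n => A l n * (n i : ℂ)

/-- The commutator with the partial derivative in direction `i`, up to `I`. -/
def mulOffDiag (i : Fin 2) (A : Kernel) : Kernel := fun l n => A l n * ((n i : ℂ) - l i)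

lemma Decay.mulFreq {σ : ℝ} {A : Kernel} (i : Fin 2) (hA : Decay σ A) :
    Decay (σ + 1 / 2) (mulFreq i A) := by
  intro N
  obtain ⟨C, hC0, hC⟩ := hA.exists_nonneg N
  refine ⟨C, fun l n => ?_⟩
  have h2 : ‖(n i : ℂ)‖ ≤ bracketSq n ^ (1 / 2 : ℝ) := by
    simpa using abs_coord_le_bracketSq_rpow n i
  simp only [TorusPDO.mulFreq, norm_mul]
  rw [Real.rpow_add (bracketSq_pos n), mul_right_comm, ← mul_assoc]
  exact mul_le_mul (hC l n) h2 (norm_nonneg _)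
    (mul_nonneg hC0 (bracketSq_rpow_pos n σ).le)

/-- The factor depends only on l - n and is bounded by one power of the off-diagonal weight, so the
order is unchanged. -/
lemma Decay.mulOffDiag {σ : ℝ} {A : Kernel} (i : Fin 2) (hA : Decay σ A) :
    Decay σ (mulOffDiag i A) := by
  intro N
  obtain ⟨C, hC0, hC⟩ := hA.exists_nonneg (N + 1)
  refine ⟨C, fun l n => le_trans ?_ (hC l n)⟩
  have h2 : ‖(n i : ℂ) - l i‖ ≤ bracketSq (l - n) := by
    have := abs_coord_le_bracketSq (l - n) i
    rw [norm_sub_rev]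
    have h3 : ((l i : ℂ) - n i) = (((l i - n i : ℤ) : ℝ) : ℂ) := by push_cast; rfl
    rw [h3, Complex.norm_real]
    simpa using this
  simp only [TorusPDO.mulOffDiag, norm_mul]
  rw [pow_succ', ← mul_assoc]
  have := pow_pos (bracketSq_pos (l - n)) N
  gcongr

lemma SymbolClass.mulFreq {j : ℕ} {σ : ℝ} {A : Kernel} (i : Fin 2) (hA : SymbolClass j σ A) :
    SymbolClass j (σ + 1 / 2) (mulFreq i A) := by
  induction j generalizing σ A with
  | zero => exact Decay.mulFreq i hA
  | succ j ih =>
    refine ⟨hA.1.mulFreq i, fun i' => ?_⟩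
    -- Leibniz rule: the difference of the factor n i is the constant 1 or 0, which leaves a term of
    -- the lower order.
    have key : TorusPDO.shift i' (TorusPDO.mulFreq i A) - TorusPDO.mulFreq i A =
        TorusPDO.mulFreq i (TorusPDO.shift i' A - A) +
          ((Pi.single i' (1 : ℤ) : Freq) i : ℂ) • TorusPDO.shift i' A := by
      ext l n
      simp [TorusPDO.shift, TorusPDO.mulFreq]
      ring
    rw [key]
    refine SymbolClass.add ((ih (hA.2 i')).mono_order (by linarith)) ?_
    exact ((hA.shift i').smul _).mono_order (by linarith)

lemma SymbolClass.mulOffDiag {j : ℕ} {σ : ℝ} {A : Kernel} (i : Fin 2)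
    (hA : SymbolClass j σ A) : SymbolClass j σ (mulOffDiag i A) := by
  induction j generalizing σ A with
  | zero => exact Decay.mulOffDiag i hA
  | succ j ih =>
    refine ⟨hA.1.mulOffDiag i, fun i' => ?_⟩
    have key : TorusPDO.shift i' (TorusPDO.mulOffDiag i A) - TorusPDO.mulOffDiag i A =
        TorusPDO.mulOffDiag i (TorusPDO.shift i' A - A) := by
      ext l n
      simp [TorusPDO.shift, TorusPDO.mulOffDiag]
      ring
    rw [key]
    exact ih (hA.2 i')

/-! ### Displacements along the diagonal and commutators with multiplication operators. -/

lemma bracketSq_single_le (i : Fin 2) (h : Freq) :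
    bracketSq (Pi.single i (h i)) ≤ bracketSq h := by
  unfold bracketSq
  fin_cases i <;> simp <;> positivity

lemma bracketSq_single_mono (i : Fin 2) {j k : ℕ} (h : j ≤ k) :
    bracketSq (Pi.single i (j : ℤ)) ≤ bracketSq (Pi.single i (k : ℤ)) := by
  have : (j : ℝ) ≤ k := by exact_mod_cast h
  unfold bracketSq
  fin_cases i <;> simp <;> gcongr

/-- Telescoping into `k` unit steps, with Peetre's inequality returning each base point to n.
Polynomial loss in the displacement is harmless, because it will meet rapidly decreasing
coefficients. -/
lemma exists_diagonal_nat_bound {ρ : ℝ} {A : Kernel} (i : Fin 2)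
    (hA : Decay ρ (shift i A - A)) (N : ℕ) :
    ∃ (C : ℝ) (M : ℕ), 0 ≤ C ∧ ∀ (k : ℕ) (l n : Freq),
      ‖A (l + Pi.single i (k : ℤ)) (n + Pi.single i (k : ℤ)) - A l n‖ * bracketSq (l - n) ^ N
        ≤ C * bracketSq (Pi.single i (k : ℤ)) ^ M * bracketSq n ^ ρ := by
  obtain ⟨M, hM⟩ := exists_bracketSq_rpow_le ρ
  obtain ⟨C, hC0, hC⟩ := hA.exists_nonneg N
  -- The additional power absorbs the number `k` of steps.
  refine ⟨C * 2 ^ M, M + 1, by positivity, fun k l n => ?_⟩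
  have hpos := bracketSq_pos (Pi.single i (k : ℤ))
  have hn := bracketSq_rpow_pos n ρ
  have key : ∀ j ≤ k,
      ‖A (l + Pi.single i (j : ℤ)) (n + Pi.single i (j : ℤ)) - A l n‖ * bracketSq (l - n) ^ N
        ≤ j * (C * 2 ^ M * bracketSq (Pi.single i (k : ℤ)) ^ M * bracketSq n ^ ρ) := by
    intro j hj
    induction j with
    | zero => simp
    | succ j ih =>
      have h1 := ih (by omega)
      have h2 := hC (l + Pi.single i (j : ℤ)) (n + Pi.single i (j : ℤ))
      have h3 := hM (n + Pi.single i (j : ℤ)) n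
      rw [add_sub_cancel_left] at h3
      rw [add_sub_add_right_eq_sub] at h2
      have h4 : bracketSq (n + Pi.single i (j : ℤ)) ^ ρ
          ≤ 2 ^ M * bracketSq (Pi.single i (k : ℤ)) ^ M * bracketSq n ^ ρ := by
        refine h3.trans ?_
        have := bracketSq_single_mono i (show j ≤ k by omega)
        have := bracketSq_pos (Pi.single i (j : ℤ))
        gcongr
      have h5 := h2.trans (mul_le_mul_of_nonneg_left h4 hC0)
      simp only [shift, Pi.sub_apply, add_assoc, ← Pi.single_add] at h5
      have h6 : ‖A (l + Pi.single i ((j + 1 : ℕ) : ℤ)) (n + Pi.single i ((j + 1 : ℕ) : ℤ)) - A l n‖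
          ≤ ‖A (l + Pi.single i ((j : ℤ) + 1)) (n + Pi.single i ((j : ℤ) + 1)) -
              A (l + Pi.single i (j : ℤ)) (n + Pi.single i (j : ℤ))‖ +
            ‖A (l + Pi.single i (j : ℤ)) (n + Pi.single i (j : ℤ)) - A l n‖ := by
        push_cast
        exact norm_sub_le_norm_sub_add_norm_sub _ _ _
      have h7 := mul_le_mul_of_nonneg_right h6 (pow_nonneg (bracketSq_pos (l - n)).le N)
      push_cast at h7 ⊢
      linarith
  refine (key k le_rfl).trans ?_
  have hk : (k : ℝ) ≤ bracketSq (Pi.single i (k : ℤ)) := by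
    simpa using abs_coord_le_bracketSq (Pi.single i (k : ℤ)) i
  calc _ ≤ bracketSq (Pi.single i (k : ℤ)) *
        (C * 2 ^ M * bracketSq (Pi.single i (k : ℤ)) ^ M * bracketSq n ^ ρ) := by gcongr
    _ = _ := by ring

lemma exists_diagonal_int_bound {ρ : ℝ} {A : Kernel} (i : Fin 2)
    (hA : Decay ρ (shift i A - A)) (N : ℕ) :
    ∃ (C : ℝ) (M : ℕ), 0 ≤ C ∧ ∀ (k : ℤ) (l n : Freq),
      ‖A (l + Pi.single i k) (n + Pi.single i k) - A l n‖ * bracketSq (l - n) ^ N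
        ≤ C * bracketSq (Pi.single i k) ^ M * bracketSq n ^ ρ := by
  obtain ⟨C, M, hC0, hC⟩ := exists_diagonal_nat_bound i hA N
  obtain ⟨M', hM'⟩ := exists_bracketSq_rpow_le ρ
  refine ⟨C * 2 ^ M', M + M', by positivity, fun k l n => ?_⟩
  have hpos := one_le_bracketSq (Pi.single i k)
  have hn := bracketSq_rpow_pos n ρ
  obtain ⟨j, rfl | rfl⟩ := k.eq_nat_or_neg
  · refine (hC j l n).trans ?_
    have : (1 : ℝ) ≤ 2 ^ M' * bracketSq (Pi.single i (j : ℤ)) ^ M' := by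
      rw [← mul_pow]; exact one_le_pow₀ (by linarith)
    calc _ ≤ C * bracketSq (Pi.single i (j : ℤ)) ^ M * bracketSq n ^ ρ *
          (2 ^ M' * bracketSq (Pi.single i (j : ℤ)) ^ M') :=
          le_mul_of_one_le_right (by positivity) this
      _ = _ := by ring
  -- A negative displacement is a positive one read from its end point; Peetre's inequality then
  -- restores the base point n.
  · have h1 := hC j (l + Pi.single i (-(j : ℤ))) (n + Pi.single i (-(j : ℤ)))
    rw [add_assoc, add_assoc, ← Pi.single_add, neg_add_cancel, Pi.single_zero, add_zero,
      add_zero, norm_sub_rev, add_sub_add_right_eq_sub] at h1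
    refine h1.trans ?_
    have h2 := hM' (n + Pi.single i (-(j : ℤ))) n
    rw [add_sub_cancel_left] at h2
    have h3 : bracketSq (Pi.single i (j : ℤ)) = bracketSq (Pi.single i (-(j : ℤ))) := by
      rw [Pi.single_neg, bracketSq_neg]
    rw [h3]
    calc _ ≤ C * bracketSq (Pi.single i (-(j : ℤ))) ^ M *
          (2 ^ M' * bracketSq (Pi.single i (-(j : ℤ))) ^ M' * bracketSq n ^ ρ) :=
          mul_le_mul_of_nonneg_left h2 (by positivity)
      _ = _ := by ring

lemma exists_diagonal_bound {ρ : ℝ} {A : Kernel}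
    (hA : ∀ i, Decay ρ (shift i A - A)) (N : ℕ) :
    ∃ (C : ℝ) (M : ℕ), 0 ≤ C ∧ ∀ h l n : Freq,
      ‖A (l + h) (n + h) - A l n‖ * bracketSq (l - n) ^ N
        ≤ C * bracketSq h ^ M * bracketSq n ^ ρ := by
  obtain ⟨C₀, M₀, hC₀, h₀⟩ := exists_diagonal_int_bound 0 (hA 0) N
  obtain ⟨C₁, M₁, hC₁, h₁⟩ := exists_diagonal_int_bound 1 (hA 1) N
  obtain ⟨M', hM'⟩ := exists_bracketSq_rpow_le ρ
  refine ⟨C₀ + C₁ * 2 ^ M', M₀ + M₁ + M', by positivity, fun h l n => ?_⟩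
  have hh := one_le_bracketSq h
  have hn := bracketSq_rpow_pos n ρ
  set u : Freq := Pi.single 0 (h 0) with hu
  set v : Freq := Pi.single 1 (h 1) with hv
  have huv : h = u + v := by
    ext i; fin_cases i <;> simp [hu, hv]
  have hub : bracketSq u ≤ bracketSq h := bracketSq_single_le 0 h
  have hvb : bracketSq v ≤ bracketSq h := bracketSq_single_le 1 h
  have a1 := h₀ (h 0) l n
  -- The displacement goes first along one axis to `u`, then along the other from there.
  have a2 := h₁ (h 1) (l + u) (n + u)
  rw [← hu] at a1
  rw [← hv, add_sub_add_right_eq_sub, add_assoc, add_assoc, ← huv] at a2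
  have a3 := hM' (n + u) n
  rw [add_sub_cancel_left] at a3
  have hu0 := bracketSq_pos u
  have hv0 := bracketSq_pos v
  have b1 : C₀ * bracketSq u ^ M₀ * bracketSq n ^ ρ
      ≤ C₀ * bracketSq h ^ (M₀ + M₁ + M') * bracketSq n ^ ρ := by
    have : bracketSq u ^ M₀ ≤ bracketSq h ^ (M₀ + M₁ + M') :=
      (pow_le_pow_left₀ hu0.le hub _).trans (pow_le_pow_right₀ hh (by omega))
    gcongr
  have b2 : C₁ * bracketSq v ^ M₁ * bracketSq (n + u) ^ ρ
      ≤ C₁ * 2 ^ M' * bracketSq h ^ (M₀ + M₁ + M') * bracketSq n ^ ρ := by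
    have : bracketSq v ^ M₁ * bracketSq u ^ M' ≤ bracketSq h ^ (M₀ + M₁ + M') := by
      calc _ ≤ bracketSq h ^ M₁ * bracketSq h ^ M' := by gcongr
        _ = bracketSq h ^ (M₁ + M') := by rw [pow_add]
        _ ≤ _ := pow_le_pow_right₀ hh (by omega)
    calc _ ≤ C₁ * bracketSq v ^ M₁ * (2 ^ M' * bracketSq u ^ M' * bracketSq n ^ ρ) :=
          mul_le_mul_of_nonneg_left a3 (by positivity)
      _ = C₁ * 2 ^ M' * (bracketSq v ^ M₁ * bracketSq u ^ M') * bracketSq n ^ ρ := by ring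
      _ ≤ _ := by gcongr
  have h6 : ‖A (l + h) (n + h) - A l n‖ ≤ ‖A (l + h) (n + h) - A (l + u) (n + u)‖ +
      ‖A (l + u) (n + u) - A l n‖ := norm_sub_le_norm_sub_add_norm_sub _ _ _
  have h7 := mul_le_mul_of_nonneg_right h6 (pow_nonneg (bracketSq_pos (l - n)).le N)
  linarith

/-- The commutator of a kernel with a multiplication operator. -/
noncomputable def commToep (A : Kernel) (α : Freq → ℂ) : Kernel :=
  comp A (toep α) - comp (toep α) A

/-- With m = n + h in one product and m = l - h in the other, both terms carry α h. What remains is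
the change of `A` from (l - h, n) to (l, n + h), a displacement by h along the diagonal. -/
lemma commToep_apply {σ : ℝ} {A : Kernel} {α : Freq → ℂ} (hA : Decay σ A) (hα : RapidDecay α)
    (l n : Freq) :
    HasSum (fun h => (A l (n + h) - A (l - h) n) * α h) (commToep A α l n) := by
  have h1 := (summable_comp hA hα.decay_toep l n).hasSum
  have h2 := (summable_comp hα.decay_toep hA l n).hasSum
  rw [← (Equiv.addLeft n).hasSum_iff] at h1
  rw [← (Equiv.subLeft l).hasSum_iff] at h2
  refine (h1.sub h2).congr_fun fun h => ?_
  simp [toep]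
  ring

/-- Each term is a diagonal displacement of `A`, hence of lower order with polynomial loss in h; the
decay of α absorbs the loss and makes the sum over h converge. -/
lemma SymbolClass.decay_commToep {σ : ℝ} {A : Kernel} {α : Freq → ℂ}
    (hA : SymbolClass 1 σ A) (hα : RapidDecay α) : Decay (σ - 1 / 2) (commToep A α) := by
  intro N
  obtain ⟨C, M, hC0, hC⟩ := exists_diagonal_bound (A := A) hA.2 N
  obtain ⟨D, hD⟩ := hα (N + M + 2)
  refine ⟨2 ^ N * C * D * ∑' h, sumWeight h, fun l n => ?_⟩
  have hn := bracketSq_rpow_pos n (σ - 1 / 2)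
  have hp : 0 < bracketSq (l - n) ^ N := pow_pos (bracketSq_pos _) N
  have hterm : ∀ h, ‖(A l (n + h) - A (l - h) n) * α h‖
      ≤ 2 ^ N * C * D * bracketSq n ^ (σ - 1 / 2) / bracketSq (l - n) ^ N * sumWeight h := by
    intro h
    have hb := bracketSq_pos h
    have h1 := hC h (l - h) n
    rw [sub_add_cancel] at h1
    have hw : bracketSq (l - n) ^ N ≤ 2 ^ N * bracketSq (l - h - n) ^ N * bracketSq h ^ N := by
      rw [← mul_pow, ← mul_pow]
      refine pow_le_pow_left₀ (bracketSq_pos _).le ?_ N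
      have := bracketSq_add_le (l - h - n) h
      rwa [show l - h - n + h = l - n by abel] at this
    rw [div_mul_eq_mul_div, le_div_iff₀ hp, norm_mul]
    have hq := sumWeight_mul h
    have hq0 := sumWeight_pos h
    calc ‖A l (n + h) - A (l - h) n‖ * ‖α h‖ * bracketSq (l - n) ^ N
        ≤ ‖A l (n + h) - A (l - h) n‖ * ‖α h‖ *
          (2 ^ N * bracketSq (l - h - n) ^ N * bracketSq h ^ N) :=
          mul_le_mul_of_nonneg_left hw (by positivity)
      _ = 2 ^ N * (‖A l (n + h) - A (l - h) n‖ * bracketSq (l - h - n) ^ N) *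
          (‖α h‖ * bracketSq h ^ N) := by ring
      _ ≤ 2 ^ N * (C * bracketSq h ^ M * bracketSq n ^ (σ - 1 / 2)) *
          (‖α h‖ * bracketSq h ^ N) := by gcongr
      _ = 2 ^ N * C * bracketSq n ^ (σ - 1 / 2) * sumWeight h *
          (‖α h‖ * bracketSq h ^ (N + M + 2)) := by
          linear_combination (-(2 ^ N * (C * bracketSq h ^ M * bracketSq n ^ (σ - 1 / 2)) *
            (‖α h‖ * bracketSq h ^ N))) * hq
      _ ≤ 2 ^ N * C * bracketSq n ^ (σ - 1 / 2) * sumWeight h * D :=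
          mul_le_mul_of_nonneg_left (hD h) (by positivity)
      _ = _ := by ring
  have hs := summable_sumWeight.mul_left
    (2 ^ N * C * D * bracketSq n ^ (σ - 1 / 2) / bracketSq (l - n) ^ N)
  have h3 := tsum_of_norm_bounded hs.hasSum hterm
  rw [(commToep_apply hA.1 hα l n).tsum_eq, tsum_mul_left, div_mul_eq_mul_div,
    le_div_iff₀ hp] at h3
  linarith

lemma SymbolClass.commToep {j : ℕ} {σ : ℝ} {A : Kernel} {α : Freq → ℂ}
    (hA : SymbolClass (j + 1) σ A) (hα : RapidDecay α) :
    SymbolClass j (σ - 1 / 2) (commToep A α) := by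
  induction j generalizing σ A with
  | zero => exact hA.decay_commToep hα
  | succ j ih =>
    have hA1 : SymbolClass 1 σ A := ⟨hA.1, fun i => (hA.2 i).decay⟩
    refine ⟨hA1.decay_commToep hα, fun i => ?_⟩
    -- Multiplication kernels are invariant under shifts, so differences fall on `A` alone.
    have key : TorusPDO.shift i (TorusPDO.commToep A α) - TorusPDO.commToep A α =
        TorusPDO.commToep (TorusPDO.shift i A - A) α := by
      have hs := (hA.shift i).decay
      simp only [TorusPDO.commToep, shift_sub, shift_comp, shift_toep]
      rw [comp_sub_left hs hA.1 hα.decay_toep, comp_sub_right hα.decay_toep hs hA.1]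
      abel
    rw [key]
    exact ih (hA.2 i)

/-! ### First order operators and the map T ↦ TQ + Q*T. -/

/-- Fourier-side data of a real first order operator: the Fourier coefficients of its
coefficient functions. -/
structure FirstOrderData where
  a : Fin 2 → Freq → ℂ
  c : Freq → ℂ
  rapid_a : ∀ j, RapidDecay (a j)
  rapid_c : RapidDecay c
  conj_a : ∀ j m, starRingEnd ℂ (a j m) = a j (-m)
  conj_c : ∀ m, starRingEnd ℂ (c m) = c (-m)

namespace FirstOrderData

variable (q : FirstOrderData)

/-- The kernel of a first order operator. -/
noncomputable def kernel : Kernel :=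
  ∑ j, Complex.I • mulFreq j (toep (q.a j)) + toep q.c

lemma symbolClass_kernel (j : ℕ) : SymbolClass j (1 / 2) q.kernel := by
  unfold kernel
  rw [Fin.sum_univ_two]
  refine ((SymbolClass.smul _ ?_).add (SymbolClass.smul _ ?_)).add ?_
  · simpa using (((q.rapid_a 0).symbolClass_toep j).mulFreq 0)
  · simpa using (((q.rapid_a 1).symbolClass_toep j).mulFreq 1)
  · exact (q.rapid_c.symbolClass_toep j).mono_order (by norm_num)

lemma decay_kernel : Decay (1 / 2) q.kernel := q.symbolClass_kernel 0

lemma kernel_apply (l n : Freq) : q.kernel l n =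
    ∑ j, Complex.I * (q.a j (l - n) * n j) + q.c (l - n) := by
  simp [kernel, mulFreq, toep]

lemma adj_kernel_apply (l n : Freq) : adj q.kernel l n =
    ∑ j, -(Complex.I * (q.a j (l - n) * l j)) + q.c (l - n) := by
  simp only [adj, kernel_apply, map_add, map_mul, map_sum, q.conj_a, q.conj_c, neg_sub,
    Complex.conj_I, map_intCast, neg_mul]

/-- The operator `T ↦ T Q + Q* T` on kernels. -/
noncomputable def symm (T : Kernel) : Kernel := comp T q.kernel + comp (adj q.kernel) T

/-- Reality of the coefficients makes the derivative terms of Q and Q* enter with opposite signs.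
For each j, writing a for multiplication by a_j, (Ta) n_j - (aT) l_j = [T, a] n_j + (aT)(n_j - l_j),
in which no term exceeds the order of `T`. -/
lemma symm_eq {σ : ℝ} {T : Kernel} (hT : Decay σ T) :
    q.symm T = ∑ j, Complex.I • (mulFreq j (commToep T (q.a j)) +
      mulOffDiag j (comp (toep (q.a j)) T)) + (comp T (toep q.c) + comp (toep q.c) T) := by
  ext l n
  have hc1 := (summable_comp hT q.rapid_c.decay_toep l n).hasSum
  have hc2 := (summable_comp q.rapid_c.decay_toep hT l n).hasSum
  have ha1 := fun j => (summable_comp hT (q.rapid_a j).decay_toep l n).hasSum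
  have ha2 := fun j => (summable_comp (q.rapid_a j).decay_toep hT l n).hasSum
  have e1 : comp T q.kernel l n = ∑ j, Complex.I * (comp T (toep (q.a j)) l n * n j) +
      comp T (toep q.c) l n := by
    refine HasSum.tsum_eq ?_
    refine HasSum.congr_fun ((hasSum_sum fun j (_ : j ∈ Finset.univ) =>
      ((ha1 j).mul_right (n j : ℂ)).mul_left Complex.I).add hc1) fun m => ?_
    simp only [kernel_apply, mul_add, Finset.mul_sum, toep]
    congr 1
    exact Finset.sum_congr rfl fun j _ => by ring
  have e2 : comp (adj q.kernel) T l n =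
      ∑ j, -(Complex.I * (comp (toep (q.a j)) T l n * l j)) + comp (toep q.c) T l n := by
    refine HasSum.tsum_eq ?_
    refine HasSum.congr_fun ((hasSum_sum fun j (_ : j ∈ Finset.univ) =>
      (((ha2 j).mul_right (l j : ℂ)).mul_left Complex.I).neg).add hc2) fun m => ?_
    simp only [adj_kernel_apply, add_mul, Finset.sum_mul, toep]
    congr 1
    exact Finset.sum_congr rfl fun j _ => by ring
  simp only [symm, Pi.add_apply, e1, e2, Pi.smul_apply, mulFreq, mulOffDiag,
    commToep, Pi.sub_apply, smul_eq_mul, Fin.sum_univ_two]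
  ring

/-- The order gained by the commutator offsets the one lost to the derivative; the cost is one
difference. -/
lemma symbolClass_symm {j : ℕ} {σ : ℝ} {T : Kernel} (hT : SymbolClass (j + 1) σ T) :
    SymbolClass j σ (q.symm T) := by
  rw [q.symm_eq hT.1, Fin.sum_univ_two]
  have hterm : ∀ i, SymbolClass j σ (Complex.I • (mulFreq i (commToep T (q.a i)) +
      mulOffDiag i (comp (toep (q.a i)) T))) := by
    intro i
    refine SymbolClass.smul _ (SymbolClass.add ?_ ?_)
    · simpa using (hT.commToep (q.rapid_a i)).mulFreq i
    · simpa using (((q.rapid_a i).symbolClass_toep j).comp hT.of_succ).mulOffDiag i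
  refine ((hterm 0).add (hterm 1)).add (SymbolClass.add ?_ ?_)
  · simpa using hT.of_succ.comp (q.rapid_c.symbolClass_toep j)
  · simpa using (q.rapid_c.symbolClass_toep j).comp hT.of_succ

lemma adj_symm {T : Kernel} (hT : adj T = T) : adj (q.symm T) = q.symm T := by
  simp only [symm, adj_add, adj_comp, adj_adj, hT]
  rw [add_comm]

end FirstOrderData

/-! ### Weighted sequence spaces and the action of matrices on them. -/

/-- Weighted square-summable sequences: Fourier coefficients of elements of `H^{2a}`. -/
def SobSeq (a : ℝ) (u : Freq → ℂ) : Prop := Summable fun n => (bracketSq n ^ a * ‖u n‖) ^ 2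

/-- The square of the weighted `ℓ²` norm. -/
noncomputable def sobSq (a : ℝ) (u : Freq → ℂ) : ℝ := ∑' n, (bracketSq n ^ a * ‖u n‖) ^ 2

lemma sobSq_nonneg (a : ℝ) (u : Freq → ℂ) : 0 ≤ sobSq a u := tsum_nonneg fun _ => sq_nonneg _

lemma SobSeq.mono {a c : ℝ} (h : a ≤ c) {u : Freq → ℂ} (hu : SobSeq c u) : SobSeq a u := by
  refine Summable.of_nonneg_of_le (fun n => sq_nonneg _) (fun n => ?_) hu
  have := Real.rpow_le_rpow_of_exponent_le (one_le_bracketSq n) h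
  have := bracketSq_rpow_pos n a
  gcongr

lemma sumWeight_le_one (h : Freq) : sumWeight h ≤ 1 :=
  inv_le_one_of_one_le₀ (one_le_pow₀ (one_le_bracketSq h))

lemma sumWeight_sub_comm (m n : Freq) : sumWeight (m - n) = sumWeight (n - m) := by
  rw [sumWeight, bracketSq_sub_comm, ← sumWeight]

lemma tsum_sumWeight_pos : 0 < ∑' h, sumWeight h :=
  summable_sumWeight.tsum_pos (fun h => (sumWeight_pos h).le) 0 (sumWeight_pos 0)

lemma hasSum_sumWeight_mul_snd {f : Freq → ℝ} (hf0 : ∀ n, 0 ≤ f n) (hf : Summable f) :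
    HasSum (fun p : Freq × Freq => sumWeight (p.1 - p.2) * f p.2)
      ((∑' h, sumWeight h) * ∑' n, f n) := by
  have h1 : Summable fun p : Freq × Freq => sumWeight (p.2 - p.1) * f p.1 := by
    refine (summable_prod_of_nonneg fun p =>
      mul_nonneg (sumWeight_pos _).le (hf0 _)).mpr ⟨fun n => ?_, ?_⟩
    · exact (summable_sumWeight_sub_right n).mul_right (f n)
    · simpa only [tsum_mul_right, tsum_sumWeight_sub_right] using hf.mul_left _
  have h2 : ∑' p : Freq × Freq, sumWeight (p.2 - p.1) * f p.1 =
      (∑' h, sumWeight h) * ∑' n, f n := by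
    rw [h1.tsum_prod]
    simp only [tsum_mul_right, tsum_sumWeight_sub_right, tsum_mul_left]
  rw [← h2]
  exact (Equiv.prodComm Freq Freq).hasSum_iff.mp h1.hasSum

lemma hasSum_sumWeight_mul_fst {f : Freq → ℝ} (hf0 : ∀ n, 0 ≤ f n) (hf : Summable f) :
    HasSum (fun p : Freq × Freq => sumWeight (p.1 - p.2) * f p.1)
      ((∑' h, sumWeight h) * ∑' n, f n) := by
  have h := (Equiv.prodComm Freq Freq).hasSum_iff.mpr (hasSum_sumWeight_mul_snd hf0 hf)
  refine h.congr_fun fun p => ?_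
  simp [sumWeight_sub_comm p.1 p.2]

lemma summable_sumWeight_mul {U : Freq → ℝ} (hU0 : ∀ n, 0 ≤ U n)
    (hU : Summable fun n => U n ^ 2) (l : Freq) : Summable fun n => sumWeight (l - n) * U n := by
  refine Summable.of_nonneg_of_le (fun n => mul_nonneg (sumWeight_pos _).le (hU0 n))
    (fun n => ?_) ((summable_sumWeight_sub_left l).add hU)
  nlinarith [sumWeight_pos (l - n), sumWeight_le_one (l - n), hU0 n, sq_nonneg (U n - 1),
    sq_nonneg (U n)]

/-- Young's convolution inequality for the weight `sumWeight`. -/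
lemma summable_sq_conv {U : Freq → ℝ} (hU0 : ∀ n, 0 ≤ U n) (hU : Summable fun n => U n ^ 2) :
    Summable (fun l => (∑' n, sumWeight (l - n) * U n) ^ 2) ∧
    ∑' l, (∑' n, sumWeight (l - n) * U n) ^ 2 ≤ (∑' h, sumWeight h) ^ 2 * ∑' n, U n ^ 2 := by
  set κ := ∑' h, sumWeight h with hκ
  have hκ0 : 0 < κ := tsum_sumWeight_pos
  have hpair := hasSum_sumWeight_mul_snd (fun n => sq_nonneg (U n)) hU
  have hS := hpair.summable.prod
  have hfib := fun l => hpair.summable.prod_factor l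
  simp only at hS hfib
  have hbound : ∀ l, (∑' n, sumWeight (l - n) * U n) ^ 2
      ≤ κ * ∑' n, sumWeight (l - n) * U n ^ 2 := by
    intro l
    set S := ∑' n, sumWeight (l - n) * U n with hSdef
    -- Cauchy–Schwarz, obtained by expanding the nonnegative sum of w(l - n)(U n - S/κ)², where S/κ
    -- is the weighted mean.
    have h1 := ((hfib l).hasSum.sub
      ((summable_sumWeight_mul hU0 hU l).hasSum.mul_left (2 * (S / κ)))).add
      ((summable_sumWeight_sub_left l).hasSum.mul_left ((S / κ) ^ 2))
    rw [tsum_sumWeight_sub_left, ← hκ, ← hSdef] at h1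
    have h2 := h1.nonneg fun n => by
      have : 0 ≤ sumWeight (l - n) * (U n - S / κ) ^ 2 :=
        mul_nonneg (sumWeight_pos _).le (sq_nonneg _)
      linarith
    have h3 : 2 * (S / κ) * S - (S / κ) ^ 2 * κ = S ^ 2 / κ := by field_simp; ring
    have h4 : S ^ 2 / κ ≤ ∑' n, sumWeight (l - n) * U n ^ 2 := by linarith
    rw [div_le_iff₀ hκ0] at h4
    linarith
  have hs : Summable (fun l => (∑' n, sumWeight (l - n) * U n) ^ 2) :=
    Summable.of_nonneg_of_le (fun l => sq_nonneg _) hbound (hS.mul_left κ)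
  refine ⟨hs, (hs.tsum_le_tsum hbound (hS.mul_left κ)).trans (le_of_eq ?_)⟩
  rw [tsum_mul_left, ← hpair.summable.tsum_prod, hpair.tsum_eq]
  ring

/-- Distributes a growth weight between the two indices. Off-diagonal powers pay for this, and two
of them are kept back as the summable weight. -/
lemma exists_rpow_le_pair {ρ a c : ℝ} (h : ρ ≤ a + c) :
    ∃ (N : ℕ) (C : ℝ), 0 ≤ C ∧ ∀ l n : Freq, bracketSq n ^ ρ
      ≤ C * bracketSq (l - n) ^ N * (sumWeight (l - n) * (bracketSq n ^ a * bracketSq l ^ c)) := by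
  obtain ⟨M, hM⟩ := exists_bracketSq_rpow_le c
  refine ⟨M + 2, 2 ^ M, by positivity, fun l n => ?_⟩
  have h1 := Real.rpow_le_rpow_of_exponent_le (one_le_bracketSq n) h
  rw [Real.rpow_add (bracketSq_pos n)] at h1
  have h2 := mul_le_mul_of_nonneg_left (hM n l) (bracketSq_rpow_pos n a).le
  rw [bracketSq_sub_comm n l] at h2
  have hq := sumWeight_mul (l - n)
  refine (h1.trans h2).trans (le_of_eq ?_)
  linear_combination (-(2 ^ M * bracketSq (l - n) ^ M * bracketSq n ^ a * bracketSq l ^ c)) * hq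

lemma Decay.exists_pair_bound {ρ a c : ℝ} {T : Kernel} (hT : Decay ρ T) (h : ρ ≤ a + c) :
    ∃ C : ℝ, 0 ≤ C ∧ ∀ l n : Freq,
      ‖T l n‖ ≤ C * (sumWeight (l - n) * (bracketSq n ^ a * bracketSq l ^ c)) := by
  obtain ⟨N, C, hC0, hC⟩ := exists_rpow_le_pair h
  obtain ⟨D, hD0, hD⟩ := hT.exists_nonneg N
  refine ⟨D * C, by positivity, fun l n => ?_⟩
  have hp : 0 < bracketSq (l - n) ^ N := pow_pos (bracketSq_pos _) N
  have h1 := (hD l n).trans (mul_le_mul_of_nonneg_left (hC l n) hD0)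
  refine le_of_mul_le_mul_right ?_ hp
  linarith

/-- The action of a kernel on a sequence. -/
noncomputable def act (A : Kernel) (u : Freq → ℂ) : Freq → ℂ := fun l => ∑' n, A l n * u n

lemma Decay.exists_act_bound {τ : ℝ} {A : Kernel} (hA : Decay τ A) (a : ℝ) :
    ∃ C : ℝ, 0 ≤ C ∧ ∀ u, SobSeq a u →
      (∀ l, Summable fun n => ‖A l n * u n‖) ∧ SobSeq (a - τ) (act A u) ∧
        sobSq (a - τ) (act A u) ≤ C * sobSq a u := by
  -- This splitting turns the action into convolution with the summable weight once input and output
  -- are rescaled, so Young's inequality applies.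
  obtain ⟨C, hC0, hC⟩ := hA.exists_pair_bound (a := a) (c := τ - a) (by linarith)
  refine ⟨(C * ∑' h, sumWeight h) ^ 2, sq_nonneg _, fun u hu => ?_⟩
  have hU0 : ∀ n, 0 ≤ bracketSq n ^ a * ‖u n‖ := fun n =>
    mul_nonneg (bracketSq_rpow_pos n a).le (norm_nonneg _)
  have hterm : ∀ l n, ‖A l n * u n‖
      ≤ C * bracketSq l ^ (τ - a) * (sumWeight (l - n) * (bracketSq n ^ a * ‖u n‖)) := by
    intro l n
    rw [norm_mul]
    calc _ ≤ C * (sumWeight (l - n) * (bracketSq n ^ a * bracketSq l ^ (τ - a))) * ‖u n‖ :=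
          mul_le_mul_of_nonneg_right (hC l n) (norm_nonneg _)
      _ = _ := by ring
  have hsum := fun l => (summable_sumWeight_mul hU0 hu l).mul_left (C * bracketSq l ^ (τ - a))
  have hs : ∀ l, Summable fun n => ‖A l n * u n‖ := fun l =>
    Summable.of_nonneg_of_le (fun n => norm_nonneg _) (hterm l) (hsum l)
  obtain ⟨hy1, hy2⟩ := summable_sq_conv hU0 hu
  have hbound : ∀ l, (bracketSq l ^ (a - τ) * ‖act A u l‖) ^ 2
      ≤ C ^ 2 * (∑' n, sumWeight (l - n) * (bracketSq n ^ a * ‖u n‖)) ^ 2 := by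
    intro l
    rw [← mul_pow]
    have hl := bracketSq_rpow_pos l (a - τ)
    refine pow_le_pow_left₀ (mul_nonneg hl.le (norm_nonneg _)) ?_ 2
    have h1 : ‖act A u l‖ ≤ C * bracketSq l ^ (τ - a) *
        ∑' n, sumWeight (l - n) * (bracketSq n ^ a * ‖u n‖) := by
      rw [← tsum_mul_left]
      exact tsum_of_norm_bounded (hsum l).hasSum (hterm l)
    have h2 : bracketSq l ^ (a - τ) * bracketSq l ^ (τ - a) = 1 := by
      rw [← Real.rpow_add (bracketSq_pos l)]; simp
    calc _ ≤ bracketSq l ^ (a - τ) * (C * bracketSq l ^ (τ - a) *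
          ∑' n, sumWeight (l - n) * (bracketSq n ^ a * ‖u n‖)) :=
          mul_le_mul_of_nonneg_left h1 hl.le
      _ = _ := by
          linear_combination (C * ∑' n, sumWeight (l - n) * (bracketSq n ^ a * ‖u n‖)) * h2
  have hS : SobSeq (a - τ) (act A u) :=
    Summable.of_nonneg_of_le (fun l => sq_nonneg _) hbound (hy1.mul_left _)
  refine ⟨hs, hS, (hS.tsum_le_tsum hbound (hy1.mul_left _)).trans ?_⟩
  rw [tsum_mul_left, mul_pow, mul_assoc]
  exact mul_le_mul_of_nonneg_left hy2 (sq_nonneg C)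

lemma Decay.sobSeq_act {τ a c : ℝ} {A : Kernel} (hA : Decay τ A) {u : Freq → ℂ}
    (hu : SobSeq a u) (h : c ≤ a - τ) : SobSeq c (act A u) := by
  obtain ⟨C, -, hC⟩ := hA.exists_act_bound a
  exact (hC u hu).2.1.mono h

/-! ### Sesquilinear forms of matrices. -/

/-- The sesquilinear form of a kernel. -/
noncomputable def form (T : Kernel) (u v : Freq → ℂ) : ℂ :=
  ∑' p : Freq × Freq, T p.1 p.2 * (u p.2 * starRingEnd ℂ (v p.1))

lemma summable_pair {a c : ℝ} {u v : Freq → ℂ} (hu : SobSeq a u) (hv : SobSeq c v) :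
    Summable fun p : Freq × Freq => sumWeight (p.1 - p.2) *
      ((bracketSq p.2 ^ a * ‖u p.2‖) * (bracketSq p.1 ^ c * ‖v p.1‖)) := by
  have h1 := (hasSum_sumWeight_mul_snd (fun n => sq_nonneg _) hu).summable
  have h2 := (hasSum_sumWeight_mul_fst (fun n => sq_nonneg _) hv).summable
  refine Summable.of_nonneg_of_le (fun p => ?_) (fun p => ?_) (h1.add h2)
  · have := bracketSq_rpow_pos p.2 a
    have := bracketSq_rpow_pos p.1 c
    have := sumWeight_pos (p.1 - p.2)
    positivity
  · rw [← mul_add]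
    refine mul_le_mul_of_nonneg_left ?_ (sumWeight_pos _).le
    nlinarith [sq_nonneg (bracketSq p.2 ^ a * ‖u p.2‖ - bracketSq p.1 ^ c * ‖v p.1‖),
      sq_nonneg (bracketSq p.2 ^ a * ‖u p.2‖), sq_nonneg (bracketSq p.1 ^ c * ‖v p.1‖)]

lemma Decay.summable_form {ρ a c : ℝ} {T : Kernel} (hT : Decay ρ T) (h : ρ ≤ a + c)
    {u v : Freq → ℂ} (hu : SobSeq a u) (hv : SobSeq c v) :
    Summable fun p : Freq × Freq => T p.1 p.2 * (u p.2 * starRingEnd ℂ (v p.1)) := by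
  obtain ⟨C, -, hC⟩ := hT.exists_pair_bound h
  refine Summable.of_norm_bounded ((summable_pair hu hv).mul_left C) fun p => ?_
  simp only [norm_mul, RCLike.norm_conj]
  calc _ ≤ C * (sumWeight (p.1 - p.2) * (bracketSq p.2 ^ a * bracketSq p.1 ^ c)) *
        (‖u p.2‖ * ‖v p.1‖) := mul_le_mul_of_nonneg_right (hC p.1 p.2) (by positivity)
    _ = _ := by ring

/-- Schur test: XY ≤ (X² + Y²)/2 reduces the double sum to two sums in which the weight has constant
total mass in the free index. -/
lemma Decay.exists_form_bound {ρ a : ℝ} {T : Kernel} (hT : Decay ρ T) (h : ρ ≤ a + a) :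
    ∃ C : ℝ, 0 ≤ C ∧ ∀ u, SobSeq a u → ‖form T u u‖ ≤ C * sobSq a u := by
  obtain ⟨C, hC0, hC⟩ := hT.exists_pair_bound h
  refine ⟨C * ∑' h, sumWeight h, mul_nonneg hC0 tsum_sumWeight_pos.le, fun u hu => ?_⟩
  have h1 := hasSum_sumWeight_mul_snd (fun n => sq_nonneg _) hu
  have h2 := hasSum_sumWeight_mul_fst (fun n => sq_nonneg _) hu
  have h3 := (h1.add h2).mul_left (C / 2)
  refine (tsum_of_norm_bounded h3 fun p => ?_).trans (le_of_eq (by unfold sobSq; ring))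
  simp only [norm_mul, RCLike.norm_conj]
  set X := bracketSq p.2 ^ a * ‖u p.2‖ with hX
  set Y := bracketSq p.1 ^ a * ‖u p.1‖ with hY
  have h4 : X * Y ≤ (X ^ 2 + Y ^ 2) / 2 := by nlinarith [sq_nonneg (X - Y)]
  calc _ ≤ C * (sumWeight (p.1 - p.2) * (bracketSq p.2 ^ a * bracketSq p.1 ^ a)) *
        (‖u p.2‖ * ‖u p.1‖) := mul_le_mul_of_nonneg_right (hC p.1 p.2) (by positivity)
    _ = C * sumWeight (p.1 - p.2) * (X * Y) := by rw [hX, hY]; ring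
    _ ≤ C * sumWeight (p.1 - p.2) * ((X ^ 2 + Y ^ 2) / 2) :=
        mul_le_mul_of_nonneg_left h4 (mul_nonneg hC0 (sumWeight_pos _).le)
    _ = _ := by ring

lemma form_eq_tsum_act {ρ a c : ℝ} {T : Kernel} (hT : Decay ρ T) (h : ρ ≤ a + c)
    {u v : Freq → ℂ} (hu : SobSeq a u) (hv : SobSeq c v) :
    form T u v = ∑' l, act T u l * starRingEnd ℂ (v l) := by
  rw [form, (hT.summable_form h hu hv).tsum_prod]
  refine tsum_congr fun l => ?_
  simp only [act, ← tsum_mul_right]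
  exact tsum_congr fun n => by ring

lemma form_conj (T : Kernel) (u v : Freq → ℂ) :
    starRingEnd ℂ (form T u v) = form (adj T) v u := by
  simp only [form, Complex.conj_tsum, map_mul, Complex.conj_conj, adj]
  rw [← (Equiv.prodComm Freq Freq).tsum_eq]
  refine tsum_congr fun p => ?_
  simp only [Equiv.prodComm_apply, Prod.fst_swap, Prod.snd_swap]
  ring

/-- Fubini for the triple sum over l, m, n. Absolute convergence needs only the total order σ + τ to
be at most a + c, with no separate condition on each factor. -/
lemma form_act_left {σ τ a c : ℝ} {A B : Kernel} (hA : Decay σ A) (hB : Decay τ B)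
    (h : σ + τ ≤ a + c) {u v : Freq → ℂ} (hu : SobSeq a u) (hv : SobSeq c v) :
    form A (act B u) v = form (comp A B) u v := by
  obtain ⟨N, D, hD0, hD⟩ := exists_rpow_le_pair h
  obtain ⟨C, hC0, hC⟩ := exists_comp_term_bound hA hB N
  have hpair := summable_pair hu hv
  set G : Freq × Freq → ℝ := fun p => sumWeight (p.1 - p.2) *
    ((bracketSq p.2 ^ a * ‖u p.2‖) * (bracketSq p.1 ^ c * ‖v p.1‖)) with hG
  have hG0 : ∀ p, 0 ≤ G p := fun p => mul_nonneg (sumWeight_pos _).le (mul_nonneg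
    (mul_nonneg (bracketSq_rpow_pos _ _).le (norm_nonneg _))
    (mul_nonneg (bracketSq_rpow_pos _ _).le (norm_nonneg _)))
  have hmaj : Summable fun t : (Freq × Freq) × Freq =>
      C * D * (sumWeight (t.2 - t.1.2) * G t.1) := by
    refine Summable.mul_left _ ((summable_prod_of_nonneg fun t =>
      mul_nonneg (sumWeight_pos _).le (hG0 _)).mpr ⟨fun p => ?_, ?_⟩)
    · exact (summable_sumWeight_sub_right p.2).mul_right (G p)
    · simp only [tsum_mul_right, tsum_sumWeight_sub_right]
      exact hpair.mul_left _
  have hF : Summable fun t : (Freq × Freq) × Freq =>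
      A t.1.1 t.2 * B t.2 t.1.2 * (u t.1.2 * starRingEnd ℂ (v t.1.1)) := by
    refine Summable.of_norm_bounded hmaj fun t => ?_
    obtain ⟨⟨l, n⟩, m⟩ := t
    simp only [norm_mul, RCLike.norm_conj]
    have hp : 0 < bracketSq (l - n) ^ N := pow_pos (bracketSq_pos _) N
    have h1 := (hC l m n).trans (mul_le_mul_of_nonneg_left (hD l n)
      (mul_nonneg hC0 (sumWeight_pos (m - n)).le))
    have h2 : ‖A l m‖ * ‖B m n‖ ≤ C * D * (sumWeight (m - n) * (sumWeight (l - n) *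
        (bracketSq n ^ a * bracketSq l ^ c))) := by
      refine le_of_mul_le_mul_right ?_ hp
      linarith
    calc _ ≤ C * D * (sumWeight (m - n) * (sumWeight (l - n) *
        (bracketSq n ^ a * bracketSq l ^ c))) * (‖u n‖ * ‖v l‖) :=
          mul_le_mul_of_nonneg_right h2 (by positivity)
      _ = _ := by simp only [hG]; ring
  have e1 : form (comp A B) u v = ∑' t : (Freq × Freq) × Freq,
      A t.1.1 t.2 * B t.2 t.1.2 * (u t.1.2 * starRingEnd ℂ (v t.1.1)) := by
    rw [hF.tsum_prod, form]
    refine tsum_congr fun p => ?_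
    rw [comp, ← tsum_mul_right]
  -- Exchanges the intermediate frequency with the one of `u`, to sum in the other order.
  let e : (Freq × Freq) × Freq ≃ (Freq × Freq) × Freq :=
    { toFun := fun t => ((t.1.1, t.2), t.1.2)
      invFun := fun t => ((t.1.1, t.2), t.1.2)
      left_inv := fun _ => rfl
      right_inv := fun _ => rfl }
  rw [e1, ← e.tsum_eq]
  have hF' := e.summable_iff.mpr hF
  simp only [Function.comp_def] at hF'
  rw [hF'.tsum_prod, form]
  refine tsum_congr fun p => ?_
  rw [act, ← tsum_mul_right, ← tsum_mul_left]
  refine tsum_congr fun n => ?_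
  simp only [e, Equiv.coe_fn_mk]
  ring

lemma form_act_right {σ τ a c : ℝ} {A B : Kernel} (hA : Decay σ A) (hB : Decay τ B)
    (h : σ + τ ≤ a + c) {u v : Freq → ℂ} (hu : SobSeq a u) (hv : SobSeq c v) :
    form A u (act B v) = form (comp (adj B) A) u v := by
  have h1 := form_act_left hA.adj hB (h.trans_eq (add_comm a c)) hv hu
  have h2 := congrArg (starRingEnd ℂ) h1
  rwa [form_conj, form_conj, adj_adj, adj_comp, adj_adj] at h2

lemma form_add {ρ a c : ℝ} {S T : Kernel} (hS : Decay ρ S) (hT : Decay ρ T) (h : ρ ≤ a + c)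
    {u v : Freq → ℂ} (hu : SobSeq a u) (hv : SobSeq c v) :
    form (S + T) u v = form S u v + form T u v := by
  simp only [form, Pi.add_apply, add_mul]
  exact (hS.summable_form h hu hv).tsum_add (hT.summable_form h hu hv)

/-! ### The energy estimate for sequences. -/

/-- The Fourier-side energy estimate. -/
theorem exists_energy_bound (q : FirstOrderData) {σ : ℝ} {P : Kernel}
    (hP : SymbolClass 2 σ P) :
    ∃ C : ℝ, 0 < C ∧ ∀ x, SobSeq (σ + 1) x →
      |(∑' l, act P (act q.kernel (act q.kernel x)) l * starRingEnd ℂ (act P x l) +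
        ∑' l, act P (act q.kernel x) l * starRingEnd ℂ (act P (act q.kernel x) l)).re|
        ≤ C * sobSq σ x := by
  set T := comp (adj P) P with hTdef
  have hT : SymbolClass 2 (σ + σ) T := hP.adj.comp hP
  have hTadj : adj T = T := by rw [hTdef, adj_comp, adj_adj]
  set S := q.symm T with hSdef
  have hS : SymbolClass 1 (σ + σ) S := q.symbolClass_symm hT
  have hSadj : adj S = S := q.adj_symm hTadj
  have hW : SymbolClass 0 (σ + σ) (q.symm S) := q.symbolClass_symm hS
  obtain ⟨C, hC0, hC⟩ := hW.decay.exists_form_bound le_rfl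
  -- The added 1 only serves to make the constant positive.
  refine ⟨C + 1, by linarith, fun x hx => ?_⟩
  have hq := q.decay_kernel
  set y := act q.kernel x with hy
  set z := act q.kernel y with hz
  have hys : SobSeq (σ + 1 / 2) y := hq.sobSeq_act hx (by linarith)
  have hzs : SobSeq σ z := hq.sobSeq_act hys (by linarith)
  have hPx : SobSeq 1 (act P x) := hP.decay.sobSeq_act hx (by linarith)
  have hPy : SobSeq (1 / 2) (act P y) := hP.decay.sobSeq_act hys (by linarith)
  have hxσ : SobSeq σ x := hx.mono (by linarith)
  have e1 : ∑' l, act P z l * starRingEnd ℂ (act P x l) = form T z x := by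
    rw [← form_eq_tsum_act hP.decay (by linarith) hzs hPx,
      form_act_right hP.decay hP.decay (by linarith) hzs hx]
  have e2 : ∑' l, act P y l * starRingEnd ℂ (act P y l) = form T y y := by
    rw [← form_eq_tsum_act hP.decay (by linarith) hys hPy,
      form_act_right hP.decay hP.decay (by linarith) hys hys]
  have hTq := hT.decay.comp hq
  have hqT := hq.adj.comp hT.decay
  -- One Q is moved across the form, so that a single symmetrized kernel acts on `y` and `x`.
  have e3 : form T z x + form T y y = form S y x := by
    rw [hz, form_act_left hT.decay hq (by linarith) hys hx]
    -- Only the second slot of `form T y y` is to be expanded as Qx.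
    nth_rewrite 3 [hy]
    rw [form_act_right hT.decay hq (by linarith) hys hx, hSdef, FirstOrderData.symm,
      form_add hTq (hqT.mono (by linarith)) (by linarith) hys hx]
  have hSq := hS.decay.comp hq
  have hqS := hq.adj.comp hS.decay
  -- Self-adjointness of S turns twice the real part into a second symmetrization. The extra
  -- regularity of `x` makes the separate sums converge; the final bound needs only order σ.
  have e4 : form S y x + starRingEnd ℂ (form S y x) = form (q.symm S) x x := by
    rw [form_conj, hSadj, hy, form_act_left hS.decay hq (by linarith) hx hx,
      form_act_right hS.decay hq (by linarith) hx hx, FirstOrderData.symm,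
      form_add hSq (hqS.mono (by linarith)) (by linarith) hx hx]
  rw [e1, e2, e3]
  have h1 := hC x hxσ
  rw [← e4, Complex.add_conj, Complex.norm_real, Real.norm_eq_abs, abs_mul, abs_two] at h1
  have := sobSq_nonneg σ x
  have := abs_nonneg (form S y x).re
  linarith

/-! ### Fourier series and Parseval's identity on the torus. -/

lemma expMode_apply (n : Freq) (x : Torus) : expMode n x = ∏ i, fourier (n i) (x i) := rfl

lemma expMode_neg (n : Freq) (x : Torus) : expMode (-n) x = starRingEnd ℂ (expMode n x) := by
  simp only [expMode_apply, Pi.neg_apply, fourier_neg, map_prod]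

lemma expMode_add (m n : Freq) (x : Torus) :
    expMode (m + n) x = expMode m x * expMode n x := by
  simp only [expMode_apply, Pi.add_apply, fourier_add, ← Finset.prod_mul_distrib]

lemma expMode_zero : expMode 0 = 1 := by
  ext x; simp [expMode_apply]

lemma norm_expMode_apply (n : Freq) (x : Torus) : ‖expMode n x‖ = 1 := by
  rw [expMode_apply, norm_prod]
  exact Finset.prod_eq_one fun i _ => by rw [fourier_apply]; exact Circle.norm_coe _

lemma expMode_single (z : Torus) (i : Fin 2) :
    expMode (Pi.single i 1) z = fourier 1 (z i) := by
  fin_cases i <;> simp [expMode_apply]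

/-- The star subalgebra of `C(𝕋², ℂ)` generated by the exponentials. -/
noncomputable def expModeSubalgebra : StarSubalgebra ℂ C(Torus, ℂ) where
  toSubalgebra := Algebra.adjoin ℂ (Set.range expMode)
  star_mem' := by
    change Algebra.adjoin ℂ (Set.range expMode) ≤ star (Algebra.adjoin ℂ (Set.range expMode))
    refine Algebra.adjoin_le ?_
    rintro _ ⟨n, rfl⟩
    refine Algebra.subset_adjoin ⟨-n, ?_⟩
    ext1 x
    simp only [expMode_neg, starRingEnd_apply, ContinuousMap.star_apply]

lemma expModeSubalgebra_coe :
    expModeSubalgebra.toSubalgebra.toSubmodule = Submodule.span ℂ (Set.range expMode) := by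
  apply Algebra.adjoin_eq_span_of_subset
  refine .trans (fun x => Submonoid.closure_induction (fun _ => id) ⟨0, ?_⟩ ?_)
    Submodule.subset_span
  · exact expMode_zero
  · rintro _ _ _ _ ⟨m, rfl⟩ ⟨n, rfl⟩
    refine ⟨m + n, ?_⟩
    ext z
    simp only [expMode_add, ContinuousMap.mul_apply]

lemma expModeSubalgebra_separatesPoints : expModeSubalgebra.SeparatesPoints := by
  intro x y hxy
  rw [Ne, funext_iff, not_forall] at hxy
  obtain ⟨i, hi⟩ := hxy
  refine ⟨_, ⟨expMode (Pi.single i 1), Algebra.subset_adjoin ⟨Pi.single i 1, rfl⟩, rfl⟩, ?_⟩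
  dsimp only
  rw [expMode_single, expMode_single, fourier_one, fourier_one]
  exact fun h => hi (AddCircle.injective_toCircle Real.two_pi_pos.ne' (Circle.coe_injective h))

lemma span_expMode_closure_eq_top :
    (Submodule.span ℂ (Set.range expMode)).topologicalClosure = ⊤ := by
  rw [← expModeSubalgebra_coe]
  exact congr_arg (Subalgebra.toSubmodule <| StarSubalgebra.toSubalgebra ·)
    (ContinuousMap.starSubalgebra_topologicalClosure_eq_top_of_separatesPoints _
      expModeSubalgebra_separatesPoints)

/-- The exponentials as elements of `L²(𝕋², ℂ)`. -/
noncomputable abbrev expLp (n : Freq) : L2C :=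
  ContinuousMap.toLp (E := ℂ) 2 (volume : Measure Torus) ℂ (expMode n)

lemma span_expLp_closure_eq_top :
    (Submodule.span ℂ (Set.range expLp)).topologicalClosure = ⊤ := by
  simpa only [Submodule.map_span, ContinuousLinearMap.coe_coe, ← Set.range_comp,
    Function.comp_def] using
    (ContinuousMap.toLp_denseRange ℂ (volume : Measure Torus) ℂ
      (p := 2) (by simp)).topologicalClosure_map_submodule span_expMode_closure_eq_top

lemma integral_fourier (n : ℤ) :
    ∫ x : AddCircle (2 * π), fourier n x = if n = 0 then ((2 * π : ℝ) : ℂ) else 0 := by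
  have h2 : ∫ x : AddCircle (2 * π), fourier n x =
      ((2 * π : ℝ) : ℂ) * ∫ x : AddCircle (2 * π), fourier n x ∂AddCircle.haarAddCircle := by
    rw [AddCircle.integral_haarAddCircle, Complex.real_smul, ← mul_assoc, ← Complex.ofReal_mul,
      mul_inv_cancel₀ Real.two_pi_pos.ne', Complex.ofReal_one, one_mul]
  have h1 := (orthonormal_iff_ite.mp (orthonormal_fourier (T := 2 * π))) 0 n
  rw [ContinuousMap.inner_toLp] at h1
  simp only [fourier_zero, map_one, mul_one] at h1
  rw [h2, h1]
  by_cases hn : n = 0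
  · simp [hn]
  · simp [hn, Ne.symm hn]

lemma integral_expMode (n : Freq) :
    ∫ x, expMode n x = if n = 0 then ((2 * π : ℝ) : ℂ) ^ 2 else 0 := by
  simp only [expMode_apply]
  rw [MeasureTheory.integral_fintype_prod_volume_eq_prod
    (fun i (x : AddCircle (2 * π)) => (fourier (n i) x : ℂ))]
  simp only [integral_fourier]
  split_ifs with h
  · subst h; simp
  · obtain ⟨i, hi⟩ := Function.ne_iff.mp h
    exact Finset.prod_eq_zero (Finset.mem_univ i) (by simpa using hi)

/-- The normalized exponentials. -/
noncomputable def unitMode (n : Freq) : L2C := (((2 * π : ℝ) : ℂ)⁻¹) • expLp n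

lemma two_pi_ne_zero_complex : ((2 * π : ℝ) : ℂ) ≠ 0 := by
  exact_mod_cast Real.two_pi_pos.ne'

lemma orthonormal_unitMode : Orthonormal ℂ unitMode := by
  rw [orthonormal_iff_ite]
  intro m n
  have h : inner ℂ (expLp m) (expLp n) = if m = n then ((2 * π : ℝ) : ℂ) ^ 2 else 0 := by
    rw [ContinuousMap.inner_toLp]
    simp only [← expMode_neg, ← expMode_add]
    rw [integral_expMode]
    exact if_congr (add_neg_eq_zero.trans eq_comm) rfl rfl
  simp only [unitMode, inner_smul_left, inner_smul_right, h, map_inv₀, Complex.conj_ofReal]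
  have := two_pi_ne_zero_complex
  split_ifs
  · field_simp
  · simp

lemma span_unitMode_closure_eq_top :
    (Submodule.span ℂ (Set.range unitMode)).topologicalClosure = ⊤ := by
  rw [eq_top_iff, ← span_expLp_closure_eq_top]
  refine Submodule.topologicalClosure_mono (Submodule.span_le.mpr ?_)
  rintro _ ⟨n, rfl⟩
  have : expLp n = ((2 * π : ℝ) : ℂ) • unitMode n := by
    rw [unitMode, smul_smul, mul_inv_cancel₀ two_pi_ne_zero_complex, one_smul]
  rw [this]
  exact Submodule.smul_mem _ _ (Submodule.subset_span ⟨n, rfl⟩)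

/-- The Fourier basis of `L²(𝕋², ℂ)`. -/
noncomputable def torusBasis : HilbertBasis Freq ℂ L2C :=
  HilbertBasis.mk orthonormal_unitMode span_unitMode_closure_eq_top.ge

/-- Fourier coefficients of complex functions on the torus. -/
noncomputable def fourierC (u : Torus → ℂ) (n : Freq) : ℂ :=
  ((2 * π : ℝ) ^ 2 : ℂ)⁻¹ * ∫ x, u x * expMode (-n) x

lemma fourierC_congr_ae {u v : Torus → ℂ} (h : u =ᵐ[volume] v) (n : Freq) :
    fourierC u n = fourierC v n := by
  unfold fourierC
  congr 1
  refine integral_congr_ae ?_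
  filter_upwards [h] with x hx
  rw [hx]

lemma torusBasis_repr (u : L2C) (n : Freq) :
    torusBasis.repr u n = ((2 * π : ℝ) : ℂ) * fourierC u n := by
  have h0 : torusBasis n = unitMode n := by simp [torusBasis]
  rw [torusBasis.repr_apply_apply, h0, unitMode, inner_smul_left, L2.inner_def, fourierC]
  have h1 : ∫ x, inner ℂ (expLp n x) (u x) = ∫ x, u x * expMode (-n) x := by
    refine integral_congr_ae ?_
    filter_upwards [ContinuousMap.coeFn_toLp (𝕜 := ℂ) (p := 2) volume (expMode n)] with x hx
    rw [hx, RCLike.inner_apply, expMode_neg]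
  rw [h1, map_inv₀, Complex.conj_ofReal, ← mul_assoc]
  have := two_pi_ne_zero_complex
  congr 1
  rw [← Complex.ofReal_pow] at *
  push_cast at *
  field_simp

lemma fourierC_eq_repr (u : L2C) (n : Freq) :
    fourierC u n = ((2 * π : ℝ) : ℂ)⁻¹ * torusBasis.repr u n := by
  rw [torusBasis_repr, ← mul_assoc, inv_mul_cancel₀ two_pi_ne_zero_complex, one_mul]

lemma L2C_ext {u v : L2C} (h : ∀ n, fourierC u n = fourierC v n) : u = v := by
  apply torusBasis.repr.injective
  ext n
  rw [torusBasis_repr, torusBasis_repr, h]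

lemma hasSum_fourierC_inner (u v : L2C) :
    HasSum (fun n => fourierC v n * starRingEnd ℂ (fourierC u n))
      ((((2 * π : ℝ) : ℂ) ^ 2)⁻¹ * inner ℂ u v) := by
  have h := (lp.hasSum_inner (torusBasis.repr u) (torusBasis.repr v)).mul_left
    ((((2 * π : ℝ) : ℂ) ^ 2)⁻¹)
  rw [LinearIsometryEquiv.inner_map_map] at h
  refine h.congr_fun fun n => ?_
  have := two_pi_ne_zero_complex
  simp only [RCLike.inner_apply, torusBasis_repr, map_mul, Complex.conj_ofReal]
  field_simp

lemma inner_eq_tsum_fourierC (u v : L2C) :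
    inner ℂ u v = ((2 * π : ℝ) : ℂ) ^ 2 *
      ∑' n, fourierC v n * starRingEnd ℂ (fourierC u n) := by
  rw [(hasSum_fourierC_inner u v).tsum_eq, ← mul_assoc,
    mul_inv_cancel₀ (pow_ne_zero 2 two_pi_ne_zero_complex), one_mul]

lemma hasSum_norm_sq_fourierC (u : L2C) :
    HasSum (fun n => ‖fourierC u n‖ ^ 2) (((2 * π) ^ 2)⁻¹ * ‖u‖ ^ 2) := by
  have h := Complex.hasSum_re (hasSum_fourierC_inner u u)
  have e : ((((2 * π : ℝ) : ℂ) ^ 2)⁻¹ * inner ℂ u u).re = ((2 * π) ^ 2)⁻¹ * ‖u‖ ^ 2 := by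
    have : inner ℂ u u = ((‖u‖ ^ 2 : ℝ) : ℂ) := by
      rw [inner_self_eq_norm_sq_to_K]
      norm_cast
    rw [this, ← Complex.ofReal_pow, ← Complex.ofReal_inv, ← Complex.ofReal_mul, Complex.ofReal_re]
  rw [e] at h
  refine h.congr_fun fun n => ?_
  rw [Complex.mul_conj, Complex.normSq_eq_norm_sq]
  norm_cast

lemma sobSeq_fourierC (u : L2C) : SobSeq 0 (fourierC u) := by
  simpa [SobSeq] using (hasSum_norm_sq_fourierC u).summable

lemma norm_sq_eq_sobSq (u : L2C) : ‖u‖ ^ 2 = (2 * π) ^ 2 * sobSq 0 (fourierC u) := by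
  have h := (hasSum_norm_sq_fourierC u).tsum_eq
  have : sobSq 0 (fourierC u) = ((2 * π) ^ 2)⁻¹ * ‖u‖ ^ 2 := by simpa [sobSq] using h
  rw [this]
  have := Real.two_pi_pos
  field_simp

lemma exists_fourierC_eq {c : Freq → ℂ} (hc : SobSeq 0 c) :
    ∃ u : L2C, ∀ n, fourierC u n = c n := by
  have hm : Memℓp (fun n => ((2 * π : ℝ) : ℂ) * c n) 2 := by
    refine memℓp_gen ?_
    have : Summable fun n => ‖c n‖ ^ 2 := by simpa [SobSeq] using hc
    refine (this.mul_left (‖((2 * π : ℝ) : ℂ)‖ ^ 2)).congr fun n => ?_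
    rw [norm_mul, ENNReal.toReal_ofNat, Real.rpow_two, mul_pow]
  refine ⟨torusBasis.repr.symm ⟨_, hm⟩, fun n => ?_⟩
  rw [fourierC_eq_repr, LinearIsometryEquiv.apply_symm_apply]
  change ((2 * π : ℝ) : ℂ)⁻¹ * (((2 * π : ℝ) : ℂ) * c n) = c n
  rw [← mul_assoc, inv_mul_cancel₀ two_pi_ne_zero_complex, one_mul]

/-- The Fourier coefficient as a continuous linear functional. -/
noncomputable def fourierCLM (n : Freq) : L2C →L[ℂ] ℂ :=
  ((2 * π : ℝ) : ℂ)⁻¹ • innerSL ℂ (torusBasis n)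

lemma fourierCLM_apply (n : Freq) (u : L2C) : fourierCLM n u = fourierC u n := by
  rw [fourierC_eq_repr, torusBasis.repr_apply_apply]
  simp [fourierCLM]

/-! ### Real functions, and products with continuous functions. -/

/-- The inclusion of real into complex functions. -/
noncomputable def complexify (f : L2R) : L2C := Complex.ofRealCLM.compLp f

lemma coeFn_complexify (f : L2R) : ∀ᵐ x : Torus, complexify f x = (f x : ℂ) := by
  filter_upwards [ContinuousLinearMap.coeFn_compLp Complex.ofRealCLM f] with x hx
  exact hx

lemma fourierC_complexify (f : L2R) (n : Freq) : fourierC (complexify f) n = coeff f n := by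
  rw [fourierC_congr_ae (coeFn_complexify f)]
  rfl

lemma norm_complexify (f : L2R) : ‖complexify f‖ = ‖f‖ := by
  rw [Lp.norm_def, Lp.norm_def]
  congr 1
  refine eLpNorm_congr_norm_ae ?_
  filter_upwards [coeFn_complexify f] with x hx
  rw [hx, Complex.norm_real]

lemma inner_complexify (f g : L2R) :
    (inner ℂ (complexify f) (complexify g)).re = inner ℝ f g := by
  have : inner ℂ (complexify f) (complexify g) = ((inner ℝ f g : ℝ) : ℂ) := by
    rw [L2.inner_def, L2.inner_def]
    refine Eq.trans ?_ (integral_ofReal (𝕜 := ℂ))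
    refine integral_congr_ae ?_
    filter_upwards [coeFn_complexify f, coeFn_complexify g] with x hf hg
    rw [hf, hg]
    simp
  rw [this, Complex.ofReal_re]

lemma conj_two_pi_sq_inv :
    starRingEnd ℂ ((((2 * π : ℝ) : ℂ) ^ 2)⁻¹) = (((2 * π : ℝ) : ℂ) ^ 2)⁻¹ := by
  rw [map_inv₀, map_pow, Complex.conj_ofReal]

lemma coeff_neg (f : L2R) (n : Freq) : coeff f (-n) = starRingEnd ℂ (coeff f n) := by
  unfold coeff
  rw [map_mul, ← integral_conj, conj_two_pi_sq_inv]
  simp [expMode_neg]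

lemma L2R_ext {f g : L2R} (h : ∀ n, coeff f n = coeff g n) : f = g := by
  have h1 : complexify f = complexify g := L2C_ext fun n => by
    rw [fourierC_complexify, fourierC_complexify, h]
  refine Lp.ext ?_
  filter_upwards [coeFn_complexify f, coeFn_complexify g] with x hf hg
  rw [h1, hg] at hf
  exact_mod_cast hf.symm

/-- The real part of the complex function with coefficients `c` has coefficients (c(n) + conj
c(-n))/2, which equal c(n) by the symmetry. -/
lemma exists_coeff_eq {c : Freq → ℂ} (hc : SobSeq 0 c)
    (hconj : ∀ n, c (-n) = starRingEnd ℂ (c n)) : ∃ f : L2R, ∀ n, coeff f n = c n := by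
  obtain ⟨u, hu⟩ := exists_fourierC_eq hc
  refine ⟨Complex.reCLM.compLp u, fun n => ?_⟩
  have hint : ∀ m, Integrable fun x => u x * expMode m x := fun m => by
    refine (Lp.memLp u).integrable (by norm_num) |>.mul_bdd (c := 1)
      (expMode m).continuous.aestronglyMeasurable ?_
    exact Filter.Eventually.of_forall fun x => (norm_expMode_apply m x).le
  have h1 : coeff (Complex.reCLM.compLp u) n = (fourierC u n +
      starRingEnd ℂ (fourierC u (-n))) / 2 := by
    unfold coeff fourierC
    rw [map_mul, ← integral_conj]
    rw [conj_two_pi_sq_inv, ← mul_add, mul_div_assoc, neg_neg]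
    congr 1
    have hi2 : Integrable fun x => starRingEnd ℂ (u x * expMode n x) :=
      (hint n).norm.mono' (Complex.continuous_conj.comp_aestronglyMeasurable
        (hint n).aestronglyMeasurable) (by simp)
    rw [← integral_add (hint (-n)) hi2, ← integral_div]
    refine integral_congr_ae ?_
    filter_upwards [ContinuousLinearMap.coeFn_compLp Complex.reCLM u] with x hx
    rw [hx, map_mul, ← expMode_neg, ← add_mul, Complex.add_conj]
    push_cast
    simp only [Complex.reCLM_apply]
    ring
  rw [h1, hu, hu, hconj, Complex.conj_conj]
  ring

lemma sobSeq_coeff (f : L2R) : SobSeq 0 (coeff f) := by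
  have := sobSeq_fourierC (complexify f)
  rwa [funext (fourierC_complexify f)] at this

lemma norm_sq_eq_sobSq_coeff (f : L2R) : ‖f‖ ^ 2 = (2 * π) ^ 2 * sobSq 0 (coeff f) := by
  rw [← norm_complexify, norm_sq_eq_sobSq, funext (fourierC_complexify f)]

lemma fourierC_mul_expMode (φ : C(Torus, ℂ)) (n l : Freq) :
    fourierC (fun x => φ x * expMode n x) l = fourierC φ (l - n) := by
  unfold fourierC
  congr 2
  ext x
  rw [mul_assoc, ← expMode_add]
  congr 3
  abel

lemma conj_fourierC (u : Torus → ℂ) (n : Freq) :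
    starRingEnd ℂ (fourierC u n) = fourierC (fun x => starRingEnd ℂ (u x)) (-n) := by
  unfold fourierC
  rw [map_mul, ← integral_conj, conj_two_pi_sq_inv]
  simp [expMode_neg]

/-- Parseval's identity for `g` against conj(φ) e_l. -/
lemma hasSum_fourierC_mul (φ : C(Torus, ℂ)) (g : L2C) (l : Freq) :
    HasSum (fun n => fourierC φ (l - n) * fourierC g n)
      (fourierC (fun x => φ x * g x) l) := by
  set ψ : C(Torus, ℂ) := star φ * expMode l with hψ
  set u : L2C := ContinuousMap.toLp (E := ℂ) 2 (volume : Measure Torus) ℂ ψ with hu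
  have hcoe := ContinuousMap.coeFn_toLp (𝕜 := ℂ) (p := 2) (volume : Measure Torus) ψ
  have h := hasSum_fourierC_inner u g
  have e : (((2 * π : ℝ) : ℂ) ^ 2)⁻¹ * inner ℂ u g = fourierC (fun x => φ x * g x) l := by
    rw [L2.inner_def, fourierC]
    congr 1
    refine integral_congr_ae ?_
    filter_upwards [hcoe] with x hx
    rw [hu, hx, RCLike.inner_apply, hψ, ContinuousMap.mul_apply, ContinuousMap.star_apply,
      map_mul, expMode_neg, ← starRingEnd_apply, Complex.conj_conj]
    ring
  rw [e] at h
  refine h.congr_fun fun n => ?_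
  have e2 : starRingEnd ℂ (fourierC u n) = fourierC φ (l - n) := by
    rw [fourierC_congr_ae hcoe, conj_fourierC, ← neg_sub n l]
    have := fourierC_mul_expMode φ (-l) (-n)
    rw [show -n - -l = -(n - l) by abel] at this
    rw [← this]
    congr 1
    ext x
    simp only [hψ, ContinuousMap.mul_apply, ContinuousMap.star_apply, map_mul, expMode_neg]
    rw [← starRingEnd_apply, Complex.conj_conj]
  rw [e2, mul_comm]

/-! ### Decay of the Fourier coefficients of smooth functions. -/

/-- The projection of the plane onto the torus. -/
noncomputable def proj (y : Fin 2 → ℝ) : Torus := fun i => (y i : AddCircle (2 * π))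

lemma proj_surjective : Function.Surjective proj := by
  intro x
  choose y hy using fun i => QuotientAddGroup.mk_surjective (x i)
  exact ⟨y, funext hy⟩

lemma proj_add (y z : Fin 2 → ℝ) : proj (y + z) = proj y + proj z := by
  ext i; simp [proj]

lemma lift_apply {E : Type*} (a : Torus → E) (y : Fin 2 → ℝ) : lift a y = a (proj y) := rfl

lemma isQuotientMap_proj : Topology.IsQuotientMap proj := by
  have h : IsOpenQuotientMap proj :=
    IsOpenQuotientMap.piMap fun _ : Fin 2 => QuotientAddGroup.isOpenQuotientMap_mk
  exact h.isQuotientMap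

lemma IsSmooth.continuous {E : Type*} [NormedAddCommGroup E] [NormedSpace ℝ E] {a : Torus → E}
    (h : IsSmooth a) : Continuous a :=
  isQuotientMap_proj.continuous_iff.mpr (ContDiff.continuous h)

lemma integral_torus_add_right (u : Torus → ℂ) (t : Torus) : ∫ x, u (x + t) = ∫ x, u x :=
  integral_add_right_eq_self u t

lemma volume_real_torus : (volume : Measure Torus).real Set.univ = (2 * π) ^ 2 := by
  have h := integral_expMode 0
  rw [expMode_zero] at h
  simp only [ContinuousMap.one_apply, integral_const, if_true] at h
  have h2 : (((volume : Measure Torus).real Set.univ : ℝ) : ℂ) = (((2 * π) ^ 2 : ℝ) : ℂ) := by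
    rw [Complex.ofReal_pow, ← h]; simp
  exact_mod_cast h2

lemma norm_fourierC_le {u : Torus → ℂ} {B : ℝ} (hB : ∀ x, ‖u x‖ ≤ B) (n : Freq) :
    ‖fourierC u n‖ ≤ B := by
  have h1 : ‖∫ x, u x * expMode (-n) x‖ ≤ B * (volume : Measure Torus).real Set.univ :=
    norm_integral_le_of_norm_le_const (Filter.Eventually.of_forall fun x => by
      rw [norm_mul, norm_expMode_apply, mul_one]; exact hB x)
  rw [volume_real_torus] at h1
  have hpi := Real.two_pi_pos
  unfold fourierC
  rw [norm_mul, norm_inv, norm_pow, Complex.norm_real, Real.norm_of_nonneg hpi.le]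
  rw [inv_mul_le_iff₀ (by positivity)]
  linarith

lemma integrable_mul_expMode {u : Torus → ℂ} (hu : Continuous u) (n : Freq) :
    Integrable fun x => u x * expMode n x :=
  (hu.mul (expMode n).continuous).integrable_of_hasCompactSupport
    (HasCompactSupport.of_compactSpace _)

lemma continuous_fwdDiff {u : Torus → ℂ} (hu : Continuous u) (t : Torus) :
    Continuous (fwdDiff t u) := by
  unfold fwdDiff; fun_prop

lemma expMode_add_right (n : Freq) (x t : Torus) :
    expMode n (x + t) = expMode n x * expMode n t := by
  simp only [expMode_apply, Pi.add_apply, fourier_apply, smul_add, AddCircle.toCircle_add,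
    Circle.coe_mul, Finset.prod_mul_distrib]

/-- Translation invariance of the measure. Finite differences in x take the place of integration by
parts. -/
lemma fourierC_fwdDiff {u : Torus → ℂ} (hu : Continuous u) (t : Torus) (n : Freq) :
    fourierC (fwdDiff t u) n = (expMode n t - 1) * fourierC u n := by
  have h1 : ∫ x, u (x + t) * expMode (-n) x = expMode n t * ∫ x, u x * expMode (-n) x := by
    rw [← integral_torus_add_right (fun x => u x * expMode (-n) x) t, ← integral_const_mul]
    refine integral_congr_ae (Filter.Eventually.of_forall fun x => ?_)
    have e2 : expMode n t * expMode (-n) t = 1 := by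
      rw [← expMode_add, add_neg_cancel, expMode_zero]; rfl
    simp only [expMode_add_right]
    linear_combination (-(u (x + t) * expMode (-n) x)) * e2
  have hi1 : Integrable fun x => u (x + t) * expMode (-n) x :=
    integrable_mul_expMode (u := fun x => u (x + t)) (by fun_prop) _
  unfold fourierC fwdDiff
  simp only [sub_mul]
  rw [integral_sub hi1 (integrable_mul_expMode hu _), h1]
  ring

lemma fourierC_fwdDiff_iterate {u : Torus → ℂ} (hu : Continuous u) (t : Torus) (n : Freq)
    (N : ℕ) : fourierC ((fwdDiff t)^[N] u) n = (expMode n t - 1) ^ N * fourierC u n := by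
  induction N generalizing u with
  | zero => simp
  | succ N ih =>
    rw [Function.iterate_succ_apply, ih (continuous_fwdDiff hu t), fourierC_fwdDiff hu]
    ring

lemma norm_fwdDiff_iterate_le {g : (Fin 2 → ℝ) → ℂ} (hg : ContDiff ℝ ∞ g) {N : ℕ} {C : ℝ}
    (hC : ∀ x, ‖iteratedFDeriv ℝ N g x‖ ≤ C) (y x : Fin 2 → ℝ) :
    ‖(fwdDiff y)^[N] g x‖ ≤ C * ‖y‖ ^ N := by
  induction N generalizing g C with
  | zero => simpa using hC x
  | succ N ih =>
    have hg' : ContDiff ℝ ∞ fun z => g (z + y) := hg.comp (contDiff_id.add contDiff_const)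
    have hd : ContDiff ℝ ∞ (fwdDiff y g) := hg'.sub hg
    rw [Function.iterate_succ_apply]
    refine (ih hd (C := C * ‖y‖) fun z => ?_).trans (le_of_eq (by ring))
    have hN : ((N : ℕ∞) : WithTop ℕ∞) ≤ ((⊤ : ℕ∞) : WithTop ℕ∞) := by exact_mod_cast le_top
    have e : iteratedFDeriv ℝ N (fwdDiff y g) z =
        iteratedFDeriv ℝ N g (z + y) - iteratedFDeriv ℝ N g z := by
      have h0 : fwdDiff y g = (fun z => g (z + y)) - g := rfl
      rw [h0, iteratedFDeriv_sub_apply (hg'.of_le hN).contDiffAt (hg.of_le hN).contDiffAt,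
        iteratedFDeriv_comp_add_right]
    rw [e]
    have hdiff : Differentiable ℝ (iteratedFDeriv ℝ N g) :=
      hg.differentiable_iteratedFDeriv (by exact_mod_cast ENat.natCast_lt_top N)
    have := Convex.norm_image_sub_le_of_norm_fderiv_le (𝕜 := ℝ) (f := iteratedFDeriv ℝ N g)
      (s := Set.univ) (x := z) (y := z + y) (C := C) (fun w _ => hdiff w)
      (fun w _ => by rw [norm_fderiv_iteratedFDeriv]; exact hC w) convex_univ trivial trivial
    simpa using this

lemma lift_fwdDiff_iterate (u : Torus → ℂ) (y : Fin 2 → ℝ) (N : ℕ) :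
    lift ((fwdDiff (proj y))^[N] u) = (fwdDiff y)^[N] (lift u) := by
  induction N generalizing u with
  | zero => rfl
  | succ N ih =>
    rw [Function.iterate_succ_apply, Function.iterate_succ_apply, ih]
    rfl

lemma expMode_proj (n : Freq) (y : Fin 2 → ℝ) :
    expMode n (proj y) = Complex.exp (Complex.I * ((n 0 * y 0 + n 1 * y 1 : ℝ) : ℂ)) := by
  have hpi : (π : ℂ) ≠ 0 := by exact_mod_cast Real.pi_ne_zero
  have h : ∀ (m : ℤ) (s : ℝ), (fourier m (s : AddCircle (2 * π)) : ℂ) =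
      Complex.exp (Complex.I * (m * s)) := by
    intro m s
    rw [fourier_coe_apply]
    congr 1
    push_cast
    field_simp
  rw [expMode_apply, Fin.prod_univ_two]
  simp only [proj, h]
  rw [← Complex.exp_add]
  congr 1
  push_cast
  ring

/-- Take 2N differences with step y = π m/|m|². Each multiplies the m-th coefficient by e_m(y) - 1 =
-2, while the differenced function is at most C‖y‖^(2N) with ‖y‖ ≤ π/|m|. The explicit linear
dependence on `B` and `C` gives uniformity in n for symbols p(x, n). -/
lemma norm_fourierC_mul_bracketSq_pow_le {φ : Torus → ℂ} (hφ : IsSmooth φ) (N : ℕ) {B C : ℝ}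
    (hB : ∀ y, ‖lift φ y‖ ≤ B) (hC : ∀ y, ‖iteratedFDeriv ℝ (2 * N) (lift φ) y‖ ≤ C)
    (m : Freq) : ‖fourierC φ m‖ * bracketSq m ^ N ≤ B + (π ^ 2) ^ N * C := by
  have hB0 : 0 ≤ B := (norm_nonneg _).trans (hB 0)
  have hC0 : 0 ≤ C := (norm_nonneg _).trans (hC 0)
  by_cases hm : m = 0
  · subst hm
    have h1 : ‖fourierC φ 0‖ ≤ B := norm_fourierC_le (fun x => by
      obtain ⟨y, rfl⟩ := proj_surjective x
      exact hB y) 0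
    rw [bracketSq_zero, one_pow, mul_one]
    have : 0 ≤ (π ^ 2) ^ N * C := by positivity
    linarith
  set r : ℝ := (m 0 : ℝ) ^ 2 + (m 1 : ℝ) ^ 2 with hr
  have hr1 : 1 ≤ r := by
    have : 1 ≤ (m 0) ^ 2 + (m 1) ^ 2 := by
      by_contra hlt
      have h0 : (m 0) ^ 2 = 0 := by nlinarith [sq_nonneg (m 0), sq_nonneg (m 1)]
      have h1 : (m 1) ^ 2 = 0 := by nlinarith [sq_nonneg (m 0), sq_nonneg (m 1)]
      refine hm (funext fun i => ?_)
      fin_cases i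
      · simpa using h0
      · simpa using h1
    rw [hr]; exact_mod_cast this
  set y : Fin 2 → ℝ := fun i => π / r * m i with hy
  have hexp : expMode m (proj y) = -1 := by
    rw [expMode_proj]
    have : (m 0 * y 0 + m 1 * y 1 : ℝ) = π := by
      simp only [hy]
      have : (m 0 : ℝ) * (π / r * m 0) + m 1 * (π / r * m 1) = π / r * r := by rw [hr]; ring
      rw [this]; field_simp
    rw [this, mul_comm, Complex.exp_pi_mul_I]
  have hynorm : ‖y‖ ^ 2 ≤ π ^ 2 / r := by
    have h1 : ‖y‖ ≤ Real.sqrt (π ^ 2 / r) := by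
      refine (pi_norm_le_iff_of_nonneg (Real.sqrt_nonneg _)).mpr fun i => ?_
      refine Real.abs_le_sqrt ?_
      have h2 : (m i : ℝ) ^ 2 ≤ r := by
        rw [hr]; fin_cases i <;> simp <;> positivity
      calc (π / r * m i) ^ 2 = π ^ 2 / r ^ 2 * (m i : ℝ) ^ 2 := by rw [mul_pow, div_pow]
        _ ≤ π ^ 2 / r ^ 2 * r := by gcongr
        _ = π ^ 2 / r := by field_simp
    calc ‖y‖ ^ 2 ≤ Real.sqrt (π ^ 2 / r) ^ 2 := by gcongr
      _ = _ := Real.sq_sqrt (by positivity)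
  have hcoef := fourierC_fwdDiff_iterate hφ.continuous (proj y) m (2 * N)
  have hle : ‖fourierC ((fwdDiff (proj y))^[2 * N] φ) m‖ ≤ C * ‖y‖ ^ (2 * N) := by
    refine norm_fourierC_le (fun x => ?_) m
    obtain ⟨z, rfl⟩ := proj_surjective x
    rw [← lift_apply ((fwdDiff (proj y))^[2 * N] φ), lift_fwdDiff_iterate]
    exact norm_fwdDiff_iterate_le hφ hC y z
  rw [hcoef, hexp, norm_mul, norm_pow] at hle
  have h2 : ‖(-1 - 1 : ℂ)‖ = 2 := by norm_num
  rw [h2, pow_mul, pow_mul] at hle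
  have h3 : (‖y‖ ^ 2) ^ N ≤ (π ^ 2 / r) ^ N := by gcongr
  -- The factor 4 is exactly what two differences, each contributing 2, can pay for.
  have hb : bracketSq m ≤ 2 ^ 2 * r := by unfold bracketSq; linarith
  have hb0 := bracketSq_pos m
  calc ‖fourierC φ m‖ * bracketSq m ^ N ≤ ‖fourierC φ m‖ * (2 ^ 2 * r) ^ N := by gcongr
    _ = ((2 ^ 2) ^ N * ‖fourierC φ m‖) * r ^ N := by rw [mul_pow]; ring
    _ ≤ C * (π ^ 2 / r) ^ N * r ^ N := by
        have := hle.trans (mul_le_mul_of_nonneg_left h3 hC0)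
        gcongr
    _ = (π ^ 2) ^ N * C := by
        rw [mul_assoc, ← mul_pow, div_mul_cancel₀ _ (by linarith)]; ring
    _ ≤ _ := by linarith

lemma exists_norm_iteratedFDeriv_lift_le {φ : Torus → ℂ} (hφ : IsSmooth φ) (N : ℕ) :
    ∃ C : ℝ, ∀ y, ‖iteratedFDeriv ℝ N (lift φ) y‖ ≤ C := by
  have hcont : Continuous (iteratedFDeriv ℝ N (lift φ)) :=
    ContDiff.continuous_iteratedFDeriv (by exact_mod_cast le_top) hφ
  obtain ⟨C, hC⟩ := (isCompact_Icc (a := (0 : Fin 2 → ℝ))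
    (b := fun _ => 2 * π)).exists_bound_of_continuousOn hcont.continuousOn
  refine ⟨C, fun y => ?_⟩
  -- Periodicity reduces the bound to the compact period square.
  set z : Fin 2 → ℝ := fun i => toIcoMod Real.two_pi_pos 0 (y i) with hz
  have hzmem : z ∈ Set.Icc (0 : Fin 2 → ℝ) (fun _ => 2 * π) := by
    refine ⟨fun i => ?_, fun i => ?_⟩
    · exact (toIcoMod_mem_Ico Real.two_pi_pos 0 (y i)).1
    · simpa using (toIcoMod_mem_Ico Real.two_pi_pos 0 (y i)).2.le
  have hproj : proj (y - z) = 0 := by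
    ext i
    simp only [proj, Pi.sub_apply, hz, self_sub_toIcoMod, Pi.zero_apply]
    rw [AddCircle.coe_eq_zero_iff]
    exact ⟨_, rfl⟩
  have hper : (fun w => lift φ (w + (y - z))) = lift φ := by
    ext w
    rw [lift_apply, lift_apply, proj_add, hproj, add_zero]
  have h := iteratedFDeriv_comp_add_right (𝕜 := ℝ) (f := lift φ) N (y - z) z
  rw [hper, add_sub_cancel] at h
  rw [← h]
  exact hC z hzmem

lemma IsSmooth.rapidDecay_fourierC {φ : Torus → ℂ} (hφ : IsSmooth φ) :
    RapidDecay (fourierC φ) := by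
  intro N
  obtain ⟨B, hB⟩ := exists_norm_iteratedFDeriv_lift_le hφ 0
  obtain ⟨C, hC⟩ := exists_norm_iteratedFDeriv_lift_le hφ (2 * N)
  exact ⟨_, norm_fourierC_mul_bracketSq_pow_le hφ N (fun y => by simpa using hB y) hC⟩

lemma IsSmooth.ofReal {a : Torus → ℝ} (ha : IsSmooth a) : IsSmooth fun x => (a x : ℂ) :=
  Complex.ofRealCLM.contDiff.comp (f := lift a) ha

/-! ### The operator Q as a matrix. -/

namespace FirstOrderOperator

variable (Q : FirstOrderOperator)

/-- The Fourier coefficients of the coefficient functions of a first order operator. -/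
noncomputable def data : FirstOrderData where
  a j := fourierC fun x => (Q.a j x : ℂ)
  c := fourierC fun x => (Q.c x : ℂ)
  rapid_a j := (Q.smooth_a j).ofReal.rapidDecay_fourierC
  rapid_c := Q.smooth_c.ofReal.rapidDecay_fourierC
  conj_a j m := by rw [conj_fourierC]; simp
  conj_c m := by rw [conj_fourierC]; simp

lemma hasSum_coeff_mul {a : Torus → ℝ} (ha : Continuous a) (g : L2R) (l : Freq) :
    HasSum (fun n => fourierC (fun x => (a x : ℂ)) (l - n) * coeff g n)
      (fourierC (fun x => (a x : ℂ) * (g x : ℂ)) l) := by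
  have h := hasSum_fourierC_mul ⟨fun x => (a x : ℂ), by fun_prop⟩ (complexify g) l
  have e : fourierC (fun x => (a x : ℂ) * complexify g x) l =
      fourierC (fun x => (a x : ℂ) * (g x : ℂ)) l := by
    refine fourierC_congr_ae ?_ l
    filter_upwards [coeFn_complexify g] with x hx
    rw [hx]
  simp only [ContinuousMap.coe_mk, fourierC_complexify] at h
  rwa [e] at h

lemma memLp_mul {a : Torus → ℝ} (ha : Continuous a) (g : L2R) :
    MemLp (fun x => a x * g x) 2 (volume : Measure Torus) := by
  obtain ⟨C, hC⟩ := isCompact_univ.exists_bound_of_continuousOn ha.continuousOn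
  refine (Lp.memLp g).of_le_mul (c := C)
    (ha.aestronglyMeasurable.mul (Lp.aestronglyMeasurable g))
    (Filter.Eventually.of_forall fun x => ?_)
  rw [norm_mul]
  exact mul_le_mul_of_nonneg_right (hC x trivial) (norm_nonneg _)

lemma integrable_ofReal_mul_expMode {u : Torus → ℝ} (hu : MemLp u 2 (volume : Measure Torus))
    (n : Freq) : Integrable fun x => (u x : ℂ) * expMode n x :=
  (hu.integrable (by norm_num)).ofReal.mul_bdd (c := 1)
    (expMode n).continuous.aestronglyMeasurable
    (Filter.Eventually.of_forall fun x => (norm_expMode_apply n x).le)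

lemma fourierC_ofReal_add {u v : Torus → ℝ} (hu : MemLp u 2 (volume : Measure Torus))
    (hv : MemLp v 2 (volume : Measure Torus)) (n : Freq) :
    fourierC (fun x => ((u x + v x : ℝ) : ℂ)) n =
      fourierC (fun x => (u x : ℂ)) n + fourierC (fun x => (v x : ℂ)) n := by
  unfold fourierC
  rw [← mul_add, ← integral_add (integrable_ofReal_mul_expMode hu _)
    (integrable_ofReal_mul_expMode hv _)]
  congr 2
  ext x
  push_cast
  ring

variable {Q}

lemma Maps.coeff_eq {f u : L2R} (h : Q.Maps f u) : coeff u = act Q.data.kernel (coeff f) := by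
  obtain ⟨D, hD, hu⟩ := h
  ext l
  have ha := fun j => (Q.smooth_a j).continuous
  have hc := Q.smooth_c.continuous
  have m0 := memLp_mul (ha 0) (D 0)
  have m1 := memLp_mul (ha 1) (D 1)
  have mc := memLp_mul hc f
  have e1 : coeff u l = fourierC (fun x =>
      ((Q.a 0 x * D 0 x + Q.a 1 x * D 1 x + Q.c x * f x : ℝ) : ℂ)) l := by
    change fourierC (fun x => (u x : ℂ)) l = _
    refine fourierC_congr_ae ?_ l
    filter_upwards [hu] with x hx
    rw [hx, Fin.sum_univ_two]
  rw [fourierC_ofReal_add (u := fun x => Q.a 0 x * D 0 x + Q.a 1 x * D 1 x) (m0.add m1) mc,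
    fourierC_ofReal_add m0 m1] at e1
  simp only [Complex.ofReal_mul] at e1
  have hs := ((hasSum_coeff_mul (ha 0) (D 0) l).add (hasSum_coeff_mul (ha 1) (D 1) l)).add
    (hasSum_coeff_mul hc f l)
  rw [← e1] at hs
  rw [← hs.tsum_eq, act]
  refine tsum_congr fun n => ?_
  rw [hD 0 n, hD 1 n, FirstOrderData.kernel_apply, Fin.sum_univ_two]
  simp only [data]
  ring

lemma exists_weakPartial {f : L2R} (hf : SobSeq (1 / 2) (coeff f)) (j : Fin 2) :
    ∃ g : L2R, IsWeakPartial j f g := by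
  refine exists_coeff_eq (c := fun n => Complex.I * (n j : ℂ) * coeff f n) ?_ fun n => ?_
  · refine Summable.of_nonneg_of_le (fun n => sq_nonneg _) (fun n => ?_) hf
    have h1 : ‖(n j : ℂ)‖ ≤ bracketSq n ^ (1 / 2 : ℝ) := by
      simpa using abs_coord_le_bracketSq_rpow n j
    rw [Real.rpow_zero, one_mul, norm_mul, norm_mul, Complex.norm_I, one_mul]
    gcongr
  · rw [coeff_neg]
    simp

variable (Q) in
lemma exists_maps {f : L2R} (hf : SobSeq (1 / 2) (coeff f)) : ∃ u, Q.Maps f u := by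
  choose D hD using exists_weakPartial hf
  have m0 := memLp_mul (Q.smooth_a 0).continuous (D 0)
  have m1 := memLp_mul (Q.smooth_a 1).continuous (D 1)
  have mc := memLp_mul Q.smooth_c.continuous f
  refine ⟨((m0.add m1).add mc).toLp _, D, hD, ?_⟩
  filter_upwards [((m0.add m1).add mc).coeFn_toLp] with x hx
  rw [hx, Fin.sum_univ_two]
  rfl

end FirstOrderOperator

/-! ### The operator P as a matrix. -/

/-- The kernel of the operator with a given symbol. -/
noncomputable def symbolKernel (p : Freq → C(Torus, ℂ)) : Kernel :=
  fun l n => fourierC (p n) (l - n)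

lemma fourierC_sub (φ ψ : C(Torus, ℂ)) (n : Freq) :
    fourierC (φ - ψ : C(Torus, ℂ)) n = fourierC φ n - fourierC ψ n := by
  unfold fourierC
  rw [← mul_sub, ← integral_sub (integrable_mul_expMode φ.continuous _)
    (integrable_mul_expMode ψ.continuous _)]
  simp only [ContinuousMap.sub_apply, sub_mul]

/-- A diagonal shift leaves l - n unchanged and moves only the frequency variable of the symbol.
This links the difference estimates of S^k to `SymbolClass`. -/
lemma shift_symbolKernel_sub (i : Fin 2) (p : Freq → C(Torus, ℂ)) :
    shift i (symbolKernel p) - symbolKernel p =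
      symbolKernel (fwdDiff (Pi.single i 1 : Freq) p) := by
  ext l n
  simp only [Pi.sub_apply, shift, symbolKernel, fwdDiff, fourierC_sub, add_sub_add_right_eq_sub]

lemma fwdDiff_comm (h k : Freq) (p : Freq → C(Torus, ℂ)) :
    fwdDiff h (fwdDiff k p) = fwdDiff k (fwdDiff h p) := by
  ext n
  simp only [fwdDiff, add_right_comm n h k]
  ring_nf

lemma fwdDiff_freqDiff (i : Fin 2) (β : Fin 2 → ℕ) (p : Freq → C(Torus, ℂ)) :
    fwdDiff (Pi.single i 1 : Freq) (freqDiff β p) = freqDiff (β + Pi.single i 1) p := by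
  have hcomm : Function.Commute
      (fwdDiff (G := C(Torus, ℂ)) (Pi.single 1 1 : Freq)) (fwdDiff (Pi.single 0 1 : Freq)) :=
    fun p => fwdDiff_comm _ _ p
  fin_cases i
  · simp [freqDiff, Function.iterate_succ_apply']
  · have := (hcomm.iterate_right (β 0)).eq ((fwdDiff (Pi.single 1 1 : Freq))^[β 1] p)
    simpa [freqDiff, Function.iterate_succ_apply'] using this

lemma IsSmooth.sub {φ ψ : Torus → ℂ} (hφ : IsSmooth φ) (hψ : IsSmooth ψ) :
    IsSmooth (φ - ψ) :=
  ContDiff.sub (f := lift φ) (g := lift ψ) hφ hψ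

lemma isSmooth_fwdDiff_iterate {p : Freq → C(Torus, ℂ)} (hp : ∀ n, IsSmooth (p n)) (h : Freq)
    (N : ℕ) (n : Freq) : IsSmooth (((fwdDiff h)^[N] p : Freq → C(Torus, ℂ)) n) := by
  induction N generalizing p with
  | zero => exact hp n
  | succ N ih =>
    rw [Function.iterate_succ_apply]
    exact ih fun m => (hp (m + h)).sub (hp m)

namespace PseudoDiffOperator

variable {k : ℝ} (P : PseudoDiffOperator k)

lemma smooth_freqDiff (β : Fin 2 → ℕ) (n : Freq) : IsSmooth (freqDiff β P.symbol n) :=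
  isSmooth_fwdDiff_iterate (isSmooth_fwdDiff_iterate P.smooth _ _) _ _ n

lemma decay_freqDiff (β : Fin 2 → ℕ) :
    Decay ((k - ((β 0 + β 1 : ℕ) : ℝ)) / 2) (symbolKernel (freqDiff β P.symbol)) := by
  intro N
  obtain ⟨B, hB⟩ := P.bound 0 β
  obtain ⟨C, hC⟩ := P.bound (2 * N) β
  refine ⟨B + (π ^ 2) ^ N * C, fun l n => ?_⟩
  refine (norm_fourierC_mul_bracketSq_pow_le (P.smooth_freqDiff β n) N
    (fun y => by rw [← norm_iteratedFDeriv_zero (𝕜 := ℝ)]; exact hB n y) (hC n) (l - n)).trans (le_of_eq (by rw [add_mul, mul_assoc]))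

lemma symbolClass_freqDiff (j : ℕ) (β : Fin 2 → ℕ) :
    SymbolClass j ((k - ((β 0 + β 1 : ℕ) : ℝ)) / 2) (symbolKernel (freqDiff β P.symbol)) := by
  induction j generalizing β with
  | zero => exact P.decay_freqDiff β
  | succ j ih =>
    refine ⟨P.decay_freqDiff β, fun i => ?_⟩
    rw [shift_symbolKernel_sub, fwdDiff_freqDiff]
    refine (ih (β + Pi.single i 1)).mono_order (le_of_eq ?_)
    fin_cases i <;> simp <;> ring

/-- The kernel of a pseudodifferential operator. -/
noncomputable def kernel : Kernel := symbolKernel P.symbol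

lemma symbolClass_kernel (j : ℕ) : SymbolClass j (k / 2) P.kernel := by
  change SymbolClass j (k / 2) (symbolKernel P.symbol)
  simpa [freqDiff] using P.symbolClass_freqDiff j 0

lemma fourierC_term (c : ℂ) (n l : Freq) :
    fourierC (c • ContinuousMap.toLp (E := ℂ) 2 (volume : Measure Torus) ℂ
      (P.symbol n * expMode n) : L2C) l = P.kernel l n * c := by
  rw [← fourierCLM_apply, map_smul, fourierCLM_apply, smul_eq_mul, mul_comm]
  congr 1
  rw [fourierC_congr_ae (ContinuousMap.coeFn_toLp (𝕜 := ℂ) (p := 2) volume _)]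
  exact fourierC_mul_expMode (P.symbol n) n l

variable {P}

lemma Maps.fourierC_eq {f : L2R} {u : L2C} (h : P.Maps f u) :
    fourierC u = act P.kernel (coeff f) := by
  ext l
  have h1 := (fourierCLM l).hasSum h
  rw [fourierCLM_apply] at h1
  rw [← h1.tsum_eq, act]
  exact tsum_congr fun n => by rw [fourierCLM_apply, fourierC_term]

variable (P) in
lemma exists_maps {f : L2R} (hf : SobSeq (k / 2) (coeff f)) : ∃ u, P.Maps f u := by
  classical
  obtain ⟨C, hC0, hC⟩ := (P.symbolClass_kernel 0).decay.exists_act_bound (k / 2)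
  set F : Freq → L2C := fun n => coeff f n •
    ContinuousMap.toLp (E := ℂ) 2 (volume : Measure Torus) ℂ (P.symbol n * expMode n) with hF
  -- A finite partial sum is P applied to the truncated coefficients, so the boundedness of the
  -- kernel yields a Cauchy criterion for unconditional convergence.
  have hnorm : ∀ t : Finset Freq, ‖∑ n ∈ t, F n‖ ^ 2
      ≤ (2 * π) ^ 2 * C * ∑ n ∈ t, (bracketSq n ^ (k / 2) * ‖coeff f n‖) ^ 2 := by
    intro t
    set x : Freq → ℂ := fun n => if n ∈ t then coeff f n else 0 with hx
    have hxs : HasSum (fun n => (bracketSq n ^ (k / 2) * ‖x n‖) ^ 2)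
        (∑ n ∈ t, (bracketSq n ^ (k / 2) * ‖coeff f n‖) ^ 2) := by
      have h1 : HasSum (fun n => (bracketSq n ^ (k / 2) * ‖x n‖) ^ 2)
          (∑ n ∈ t, (bracketSq n ^ (k / 2) * ‖x n‖) ^ 2) :=
        hasSum_sum_of_ne_finset_zero fun n hn => by simp [hx, hn]
      have h2 : ∑ n ∈ t, (bracketSq n ^ (k / 2) * ‖x n‖) ^ 2 =
          ∑ n ∈ t, (bracketSq n ^ (k / 2) * ‖coeff f n‖) ^ 2 :=
        Finset.sum_congr rfl fun n hn => by simp only [hx, hn, if_true]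
      rwa [h2] at h1
    have hfc : fourierC (∑ n ∈ t, F n : L2C) = act P.kernel x := by
      ext l
      rw [← fourierCLM_apply, map_sum, act, tsum_eq_sum (s := t) fun n hn => by simp [hx, hn]]
      refine Finset.sum_congr rfl fun n hn => ?_
      rw [fourierCLM_apply, hF, fourierC_term, hx]
      simp only [hn, if_true]
    have h2 := (hC x hxs.summable).2.2
    rw [sub_self] at h2
    rw [norm_sq_eq_sobSq, hfc, mul_assoc]
    refine mul_le_mul_of_nonneg_left (h2.trans (le_of_eq ?_)) (by positivity)
    rw [sobSq, hxs.tsum_eq]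
  have hsum : Summable F := by
    rw [summable_iff_vanishing_norm]
    intro ε hε
    have h3 := (hf.mul_left ((2 * π) ^ 2 * C))
    rw [summable_iff_vanishing_norm] at h3
    obtain ⟨s, hs⟩ := h3 (ε ^ 2) (by positivity)
    refine ⟨s, fun t ht => ?_⟩
    have h4 := hs t ht
    rw [← Finset.mul_sum] at h4
    exact lt_of_pow_lt_pow_left₀ 2 hε.le
      ((hnorm t).trans_lt ((le_abs_self _).trans_lt h4))
  exact ⟨_, hsum.hasSum⟩

end PseudoDiffOperator

/-! ### Sobolev norms, the identity operator, and the transfer to functions. -/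

lemma MemSobolev.sobSeq {s : ℝ} {f : L2R} (h : MemSobolev s f) : SobSeq (s / 2) (coeff f) := by
  obtain ⟨g, hg⟩ := h
  refine (sobSeq_coeff g).congr fun n => ?_
  rw [hg n, norm_mul, Complex.norm_real, Real.norm_of_nonneg (bracketSq_rpow_pos n _).le]
  simp

lemma sobolevNorm_sq {s : ℝ} {f : L2R} (h : SobSeq (s / 2) (coeff f)) :
    sobolevNorm s f ^ 2 = (2 * π) ^ 2 * sobSq (s / 2) (coeff f) := by
  have hnorm : ∀ n, ‖((bracketSq n ^ (s / 2) : ℝ) : ℂ) * coeff f n‖ =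
      bracketSq n ^ (s / 2) * ‖coeff f n‖ := fun n => by
    rw [norm_mul, Complex.norm_real, Real.norm_of_nonneg (bracketSq_rpow_pos n _).le]
  obtain ⟨g, hg⟩ : ∃ g : L2R, IsBesselPotential s f g := by
    refine exists_coeff_eq (h.congr fun n => ?_) fun n => ?_
    · rw [hnorm]; simp
    · rw [coeff_neg, bracketSq_neg, map_mul, Complex.conj_ofReal]
  have hset : {r : ℝ | ∃ g : L2R, IsBesselPotential s f g ∧ r = ‖g‖} = {‖g‖} := by
    ext r
    constructor
    · rintro ⟨g', hg', rfl⟩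
      have : g' = g := L2R_ext fun n => by rw [hg' n, hg n]
      rw [this]; rfl
    · rintro rfl
      exact ⟨g, hg, rfl⟩
  rw [sobolevNorm, hset, csInf_singleton, norm_sq_eq_sobSq_coeff]
  congr 1
  refine tsum_congr fun n => ?_
  rw [hg n, hnorm]
  simp

/-- The kernel of the identity operator. -/
noncomputable def idKernel : Kernel := toep (Pi.single 0 1)

lemma rapidDecay_single : RapidDecay (Pi.single (0 : Freq) (1 : ℂ)) := by
  intro N
  refine ⟨1, fun m => ?_⟩
  by_cases hm : m = 0
  · subst hm; simp [bracketSq_zero]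
  · simp [hm]

lemma symbolClass_idKernel (j : ℕ) : SymbolClass j 0 idKernel :=
  rapidDecay_single.symbolClass_toep j

lemma act_idKernel (u : Freq → ℂ) : act idKernel u = u := by
  ext l
  rw [act, tsum_eq_single l fun n hn => by
    simp [idKernel, toep, sub_eq_zero, Ne.symm hn]]
  simp [idKernel, toep]

/-- Here `inner` is conjugate-linear in its first argument; taking real parts makes the order of the
arguments irrelevant. -/
lemma re_inner_add_eq (u v w z : L2C) :
    (inner ℂ u v + inner ℂ w z).re = (2 * π) ^ 2 *
      (∑' n, fourierC u n * starRingEnd ℂ (fourierC v n) +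
        ∑' n, fourierC w n * starRingEnd ℂ (fourierC z n)).re := by
  have h : ∀ a b : L2C, (inner ℂ a b).re =
      (2 * π) ^ 2 * (∑' n, fourierC a n * starRingEnd ℂ (fourierC b n)).re := fun a b => by
    rw [← Complex.re_ofReal_mul]
    have h1 : (inner ℂ a b).re = (inner ℂ b a).re := inner_re_symm (𝕜 := ℂ) a b
    rw [h1, inner_eq_tsum_fourierC, ← Complex.ofReal_pow]
  rw [Complex.add_re, Complex.add_re, h, h, mul_add]

end TorusPDO

theorem theorem3p15 (Q : TorusPDO.FirstOrderOperator) :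
    (∃ C : ℝ, 0 < C ∧ ∀ f : TorusPDO.L2R, TorusPDO.MemSobolev 2 f →
      (∃ Qf QQf : TorusPDO.L2R, Q.Maps f Qf ∧ Q.Maps Qf QQf) ∧
      ∀ Qf QQf : TorusPDO.L2R, Q.Maps f Qf → Q.Maps Qf QQf →
        |inner ℝ QQf f + inner ℝ Qf Qf| ≤ C * ‖f‖ ^ 2) ∧
    (∀ (k : ℝ), 1 ≤ k → ∀ P : TorusPDO.PseudoDiffOperator k,
      ∃ C : ℝ, 0 < C ∧ ∀ f : TorusPDO.L2R, TorusPDO.MemSobolev (2 + k) f →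
        (∃ (Qf QQf : TorusPDO.L2R) (Pf PQf PQQf : TorusPDO.L2C),
          Q.Maps f Qf ∧ Q.Maps Qf QQf ∧ P.Maps f Pf ∧ P.Maps Qf PQf ∧ P.Maps QQf PQQf) ∧
        ∀ (Qf QQf : TorusPDO.L2R) (Pf PQf PQQf : TorusPDO.L2C),
          Q.Maps f Qf → Q.Maps Qf QQf → P.Maps f Pf → P.Maps Qf PQf → P.Maps QQf PQQf →
            |(inner ℂ PQQf Pf + inner ℂ PQf PQf).re| ≤ C * TorusPDO.sobolevNorm k f ^ 2) := by
  open TorusPDO in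
  have hpi : (0 : ℝ) ≤ (2 * π) ^ 2 := by positivity
  -- Each application of Q costs 1/2 in the exponent, that is, one derivative; both claims use this,
  -- with a = 0 and a = k/2.
  have hdom : ∀ (a : ℝ), 0 ≤ a → ∀ f : L2R, SobSeq (a + 1) (coeff f) →
      ∃ Qf QQf : L2R, Q.Maps f Qf ∧ Q.Maps Qf QQf ∧
        SobSeq a (coeff Qf) ∧ SobSeq a (coeff QQf) := by
    intro a ha f hf
    obtain ⟨Qf, h1⟩ := Q.exists_maps (hf.mono (show 1 / 2 ≤ a + 1 by linarith))
    have hs1 : SobSeq (a + 1 / 2) (coeff Qf) := by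
      rw [h1.coeff_eq]; exact Q.data.decay_kernel.sobSeq_act hf (by linarith)
    obtain ⟨QQf, h2⟩ := Q.exists_maps (hs1.mono (show 1 / 2 ≤ a + 1 / 2 by linarith))
    have hs2 : SobSeq a (coeff QQf) := by
      rw [h2.coeff_eq]; exact Q.data.decay_kernel.sobSeq_act hs1 (by linarith)
    exact ⟨Qf, QQf, h1, h2, hs1.mono (by linarith), hs2⟩
  refine ⟨?_, fun k hk P => ?_⟩
  -- The first claim is the energy estimate with P the identity and σ = 0.
  · obtain ⟨C, hC0, hC⟩ := exists_energy_bound Q.data (symbolClass_idKernel 2)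
    refine ⟨C, hC0, fun f hf => ?_⟩
    have hfs : SobSeq (0 + 1) (coeff f) := by simpa using hf.sobSeq
    refine ⟨?_, fun Qf QQf h1 h2 => ?_⟩
    · obtain ⟨Qf, QQf, h1, h2, -⟩ := hdom 0 le_rfl f hfs
      exact ⟨Qf, QQf, h1, h2⟩
    have h3 := hC (coeff f) hfs
    simp only [act_idKernel] at h3
    rw [← h1.coeff_eq, ← h2.coeff_eq] at h3
    rw [← inner_complexify, ← inner_complexify, ← Complex.add_re, re_inner_add_eq, abs_mul,
      abs_of_nonneg hpi, norm_sq_eq_sobSq_coeff]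
    simp only [fourierC_complexify]
    linarith [mul_le_mul_of_nonneg_left h3 hpi]
  · obtain ⟨C, hC0, hC⟩ := exists_energy_bound Q.data (P.symbolClass_kernel 2)
    refine ⟨C, hC0, fun f hf => ?_⟩
    have hfs : SobSeq (k / 2 + 1) (coeff f) := by
      have := hf.sobSeq
      rwa [show (2 + k) / 2 = k / 2 + 1 by ring] at this
    have hfk : SobSeq (k / 2) (coeff f) := hfs.mono (by linarith)
    refine ⟨?_, fun Qf QQf Pf PQf PQQf h1 h2 h3 h4 h5 => ?_⟩
    · obtain ⟨Qf, QQf, h1, h2, hs1, hs2⟩ := hdom (k / 2) (by linarith) f hfs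
      obtain ⟨Pf, h3⟩ := P.exists_maps hfk
      obtain ⟨PQf, h4⟩ := P.exists_maps hs1
      obtain ⟨PQQf, h5⟩ := P.exists_maps hs2
      exact ⟨Qf, QQf, Pf, PQf, PQQf, h1, h2, h3, h4, h5⟩
    have h6 := hC (coeff f) hfs
    rw [← h1.coeff_eq, ← h2.coeff_eq, ← h3.fourierC_eq, ← h4.fourierC_eq, ← h5.fourierC_eq] at h6
    rw [re_inner_add_eq, abs_mul, abs_of_nonneg hpi, sobolevNorm_sq hfk]
    linarith [mul_le_mul_of_nonneg_left h6 hpi]
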